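/- Let $K$ be a commutative ring and let $\Lambda$ (resp. $\widehat\Lambda$) be the $K$-algebra of symmetric formal power series of bounded (resp. arbitrary) degree in $x_1,x_2,\dots$ with coefficients in $K$. Let $(\,,)\colon\widehat\Lambda\times\Lambda\to K$ be the Hall inner product, $\big(\sum_\lambda A_\lambda s_\lambda,\sum_\lambda B_\lambda s_\lambda\big)=\sum_\lambda A_\lambda B_\lambda$, where $s_\lambda$ are the Schur functions. For $t\in K$ let $E(t)=\sum_{i\ge 0}t^i e_i\in\widehat\Lambda$, where $e_i$ are the elementary symmetric functions. For a skew shape $\lambda/\mu$ (partitions $\mu\subset\lambda$), the dual stable Grothendieck polynomial is $g_{\lambda/\mu}=\sum_T\prod_i x_i^{T(i)}$, summed over the fillings $T$ of the boxes of $\lambda/\mu$ with positive integers that increase weakly along every row and every column, where $T(i)$ is the number of columns of $T$ that contain $i$; write $g_\lambda=g_{\lambda/\emptyset}$. Let $|\lambda/\mu|$ be the number of boxes of $\lambda/\mu$ and $c(\lambda/\mu)$ the number of columns containing at least one box of $\lambda/\mu$; $\lambda/\mu$ is a vertical strip if it has at most one box in each row. Then $g_{\lambda/\mu}\in\Lambda$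 for every skew shape $\lambda/\mu$, and for every $t\in K$ the map $(E(t),-)\colon\Lambda\to K$ is a $K$-algebra homomorphism which satisfies, for every skew shape $\lambda/\mu$, $$(E(t),g_{\lambda/\mu})=\begin{cases}t^{c(\lambda/\mu)}(t+1)^{|\lambda/\mu|-c(\lambda/\mu)}&\text{if }\lambda/\mu\text{ is a vertical strip},\\0&\text{otherwise.}\end{cases}$$ In particular, for every partition $\lambda$, $$(E(t),g_\lambda)=\begin{cases}1&\text{if }\lambda=\emptyset,\\t(t+1)^{n-1}&\text{if }\lambda=(1^n)\ (n\ge1),\\0&\text{otherwise.}\end{cases}$$ -/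

import Mathlib

namespace DualGrothendieck

/-! ### Symmetric functions

The variables `x₁, x₂, …` are indexed by `ℕ`, so that `x_{k+1}` is the variable with index `k`. -/

/-- The completed ring of symmetric functions: all symmetric formal power series in countably many
variables, of possibly unbounded degree. -/
noncomputable def SymSeries (K : Type*) [CommRing K] : Subalgebra K (MvPowerSeries ℕ K) where
  carrier := {F | ∀ σ : Equiv.Perm ℕ, MvPowerSeries.renameEquiv K σ F = F}
  mul_mem' := by
    intro a b ha hb σ
    rw [map_mul, ha σ, hb σ]
  add_mem' := by
    intro a b ha hb σ
    rw [map_add, ha σ, hb σ]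
  algebraMap_mem' := by
    intro r σ
    exact AlgEquiv.commutes _ r

/-- The ring of symmetric functions: symmetric formal power series of bounded degree. -/
noncomputable def SymFun (K : Type*) [CommRing K] : Subalgebra K (MvPowerSeries ℕ K) where
  carrier := {F | F ∈ SymSeries K ∧
    ∃ N : ℕ, ∀ d : ℕ →₀ ℕ, N < d.degree → MvPowerSeries.coeff d F = 0}
  mul_mem' := by
    classical
    rintro a b ⟨ha, N, hN⟩ ⟨hb, M, hM⟩
    refine ⟨mul_mem ha hb, N + M, fun d hd => ?_⟩
    rw [MvPowerSeries.coeff_mul]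
    refine Finset.sum_eq_zero fun p hp => ?_
    rw [Finset.HasAntidiagonal.mem_antidiagonal] at hp
    have hdeg : p.1.degree + p.2.degree = d.degree := by rw [← hp, map_add]
    by_cases h : N < p.1.degree
    · rw [hN _ h, zero_mul]
    · rw [hM _ (by omega), mul_zero]
  add_mem' := by
    rintro a b ⟨ha, N, hN⟩ ⟨hb, M, hM⟩
    refine ⟨add_mem ha hb, N + M, fun d hd => ?_⟩
    rw [map_add, hN _ (by omega), hM _ (by omega), add_zero]
  algebraMap_mem' := by
    classical
    intro r
    refine ⟨Subalgebra.algebraMap_mem _ r, 0, fun d hd => ?_⟩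
    have hd0 : d ≠ 0 := by
      rintro rfl
      simp at hd
    rw [← MvPowerSeries.c_eq_algebraMap, MvPowerSeries.coeff_C, if_neg hd0]

/-- The Schur function of a Young diagram: the generating function of semistandard tableaux. The
coefficient of `x ^ d` is the number of tableaux in which each `k` occurs exactly `d k` times. -/
noncomputable def schur (K : Type*) [CommRing K] (lam : YoungDiagram) : MvPowerSeries ℕ K :=
  fun d => (Nat.card {T : SemistandardYoungTableau lam //
    ∀ k, (lam.cells.filter fun c => T c.1 c.2 = k).card = d k} : K)

/-- `F = ∑ A_lam s_lam`, a possibly infinite linear combination, taken coefficientwise (for a given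
monomial only finitely many Schur functions contribute, as they are homogeneous). -/
def IsSchurExpansion {K : Type*} [CommRing K] (F : MvPowerSeries ℕ K) (A : YoungDiagram → K) :
    Prop :=
  ∀ d : ℕ →₀ ℕ, MvPowerSeries.coeff d F =
    ∑ᶠ lam : YoungDiagram, A lam * MvPowerSeries.coeff d (schur K lam)

open Classical in
/-- The coefficients of a symmetric series in its (unique) expansion into Schur functions. -/
noncomputable def schurCoeff {K : Type*} [CommRing K] (F : MvPowerSeries ℕ K) :
    YoungDiagram → K :=
  if h : ∃ A, IsSchurExpansion F A then h.choose else 0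

/-- The Hall inner product, extended to symmetric series in its first argument: the form for which
the Schur functions are orthonormal, `(∑ A_lam s_lam, ∑ B_lam s_lam) = ∑ A_lam B_lam`. The sum is
finite because the second argument has bounded degree. -/
noncomputable def hall {K : Type*} [CommRing K] (F : SymSeries K) (f : SymFun K) : K :=
  ∑ᶠ lam : YoungDiagram,
    schurCoeff (F : MvPowerSeries ℕ K) lam * schurCoeff (f : MvPowerSeries ℕ K) lam

/-- The elementary symmetric function `e_i`: the sum of all squarefree monomials of degree `i`. -/
noncomputable def elem (K : Type*) [CommRing K] (i : ℕ) : MvPowerSeries ℕ K :=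
  open Classical in fun d => if (∀ k, d k ≤ 1) ∧ d.degree = i then 1 else 0

/-- The series `∑ i, t ^ i * e_i`, the sum being taken coefficientwise. -/
noncomputable def elemGen {K : Type*} [CommRing K] (t : K) : MvPowerSeries ℕ K :=
  fun d => ∑ᶠ i : ℕ, t ^ i * MvPowerSeries.coeff d (elem K i)

theorem elemGen_mem {K : Type*} [CommRing K] (t : K) : elemGen t ∈ SymSeries K := by
  classical
  have key : ∀ (σ : Equiv.Perm ℕ) (d : ℕ →₀ ℕ) (i : ℕ),
      MvPowerSeries.coeff (Finsupp.embDomain σ.toEmbedding d) (elem K i) =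
        MvPowerSeries.coeff d (elem K i) := by
    intro σ d i
    have h1 : (∀ k, Finsupp.embDomain σ.toEmbedding d k ≤ 1) ↔ ∀ k, d k ≤ 1 := by
      constructor
      · intro h k
        have := h (σ.toEmbedding k)
        rwa [Finsupp.embDomain_apply_self] at this
      · intro h k
        obtain ⟨m, rfl⟩ := σ.surjective k
        have := Finsupp.embDomain_apply_self σ.toEmbedding d m
        rw [Equiv.coe_toEmbedding] at this
        rw [this]
        exact h m
    have h2 : (Finsupp.embDomain σ.toEmbedding d).degree = d.degree := by
      rw [Finsupp.degree_apply, Finsupp.degree_apply, Finsupp.support_embDomain, Finset.sum_map]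
      exact Finset.sum_congr rfl fun x _ => Finsupp.embDomain_apply_self _ _ _
    change (if (∀ k, Finsupp.embDomain σ.toEmbedding d k ≤ 1) ∧
      (Finsupp.embDomain σ.toEmbedding d).degree = i then (1 : K) else 0) =
        if (∀ k, d k ≤ 1) ∧ d.degree = i then 1 else 0
    rw [h1, h2]
  intro σ
  ext x
  obtain ⟨d, rfl⟩ : ∃ d, Finsupp.embDomain σ.toEmbedding d = x :=
    ⟨Finsupp.embDomain σ.symm.toEmbedding x, by
      ext k
      obtain ⟨m, rfl⟩ := σ.surjective k
      have h1 := Finsupp.embDomain_apply_self σ.toEmbedding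
        (Finsupp.embDomain σ.symm.toEmbedding x) m
      have h2 := Finsupp.embDomain_apply_self σ.symm.toEmbedding x (σ m)
      simp only [Equiv.coe_toEmbedding, Equiv.symm_apply_apply] at h1 h2
      rw [h1, h2]⟩
  have h := MvPowerSeries.coeff_embDomain_rename σ.toEmbedding (elemGen t) d
  have h' : MvPowerSeries.coeff (Finsupp.embDomain σ.toEmbedding d) (elemGen t) =
      MvPowerSeries.coeff d (elemGen t) := by
    change ∑ᶠ i : ℕ, _ = ∑ᶠ i : ℕ, _
    simp only [key]
  rw [h']
  exact h

/-- `E(t) = ∑ i, t ^ i * e_i` as an element of the completed ring of symmetric functions. -/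
noncomputable def E {K : Type*} [CommRing K] (t : K) : SymSeries K := ⟨elemGen t, elemGen_mem t⟩

/-! ### Skew shapes and dual stable Grothendieck polynomials

A skew shape `lam / μ` is given by Young diagrams `μ ≤ lam`. A cell `(i, j)` lies in row `i` and
column `j`. -/

/-- The boxes of the skew shape `lam / μ`. -/
def skewCells (lam μ : YoungDiagram) : Finset (ℕ × ℕ) := lam.cells \ μ.cells

/-- `c(lam / μ)`: the number of columns that contain a box of `lam / μ`. -/
def numCols (lam μ : YoungDiagram) : ℕ := ((skewCells lam μ).image Prod.snd).card

/-- `lam / μ` is a vertical strip: no row contains two of its boxes. -/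
def IsVerticalStrip (lam μ : YoungDiagram) : Prop :=
  ∀ a ∈ skewCells lam μ, ∀ b ∈ skewCells lam μ, a.1 = b.1 → a = b

instance (lam μ : YoungDiagram) : Decidable (IsVerticalStrip lam μ) :=
  inferInstanceAs (Decidable (∀ a ∈ skewCells lam μ, ∀ b ∈ skewCells lam μ, a.1 = b.1 → a = b))

/-- A reverse plane partition of shape `lam / μ`: a filling of the boxes, weakly increasing along
rows and columns. An entry `k` stands for the positive integer `k + 1`; outside the shape the
function vanishes by convention. -/
@[ext]
structure ReversePlanePartition (lam μ : YoungDiagram) where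
  entry : ℕ → ℕ → ℕ
  row_weak : ∀ {i j₁ j₂ : ℕ}, j₁ < j₂ → (i, j₁) ∈ skewCells lam μ → (i, j₂) ∈ skewCells lam μ →
    entry i j₁ ≤ entry i j₂
  col_weak : ∀ {i₁ i₂ j : ℕ}, i₁ < i₂ → (i₁, j) ∈ skewCells lam μ → (i₂, j) ∈ skewCells lam μ →
    entry i₁ j ≤ entry i₂ j
  zeros : ∀ {i j : ℕ}, (i, j) ∉ skewCells lam μ → entry i j = 0

/-- The number of columns of `T` that contain the entry `k`. -/
def ReversePlanePartition.colCount {lam μ : YoungDiagram} (T : ReversePlanePartition lam μ)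
    (k : ℕ) : ℕ :=
  (((skewCells lam μ).filter fun c => T.entry c.1 c.2 = k).image Prod.snd).card

/-- The dual stable Grothendieck polynomial `g_{lam / μ}`, the sum over reverse plane partitions `T`
of the monomials in which the variable with index `k` has as exponent the number of columns of `T`
containing `k`. -/
noncomputable def dualGroth (K : Type*) [CommRing K] (lam μ : YoungDiagram) : MvPowerSeries ℕ K :=
  fun d => (Nat.card {T : ReversePlanePartition lam μ // ∀ k, T.colCount k = d k} : K)

/-- The one-column partition `(1 ^ n)`. -/
def oneColumn (n : ℕ) : YoungDiagram where
  cells := Finset.range n ×ˢ {0}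
  isLowerSet := by
    rintro ⟨a, b⟩ ⟨c, d⟩ h hab
    simp only [Prod.mk_le_mk] at h
    simp only [Finset.coe_product, Finset.coe_range, Finset.coe_singleton, Set.mem_prod,
      Set.mem_Iio, Set.mem_singleton_iff] at hab ⊢
    omega

end DualGrothendieck

/-!
Adding one entry to a reverse plane partition enlarges its shape by one skew shape `ν / μ`, in which
every column contributes one factor `x`. The generating functions of reverse plane partitions are
therefore entries of products of operators `colOp s x` (matrices indexed by Young diagrams), where
`s` marks the boxes that repeat the entry above them: `s = 1` gives the dual stable Grothendieck
polynomials and, for straight shapes, `s = 0` gives the Schur functions. These operators are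
unitriangular and commute, hence the symmetry, and for `n` equal variables one obtains the power
`colOp s x ^ n`, whose entries are polynomial sequences in `n`.

Polynomial sequences have a value at `n = -1`, which over an arbitrary ring is obtained by inverting
the shift `n ↦ n + 1`. So `f ↦ f(-t, …, -t)` at `-1` variables is an algebra homomorphism. It takes
generating functions to entries of the inverse of `colOp s (-t)`, and this inverse is supported on
vertical strips, where it is the product of the factors `t (t + s) ^ (m - 1)` over the columns with
`m > 0` boxes. For `s = 0` these are the Schur coefficients of `E t`, so the homomorphism is the
pairing with `E t`; for `s = 1` they are the asserted values.
-/

namespace DualGrothendieck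

open Finset

/-! ### Polynomial sequences -/

section PolynomialSeq

variable {K : Type*} [CommRing K]

theorem fwdDiff_iter_eq_zero_mono {f : ℕ → K} {m n : ℕ} (hmn : m ≤ n)
    (hf : (fwdDiff 1)^[m] f = 0) : (fwdDiff 1)^[n] f = 0 := by
  obtain ⟨k, rfl⟩ := Nat.exists_eq_add_of_le' hmn
  rw [Function.iterate_add_apply, hf]
  exact Function.iterate_fixed (fwdDiff_const 1 (0 : K)) k

theorem fwdDiff_iter_mul_eq_zero {m n : ℕ} {f g : ℕ → K} (hf : (fwdDiff 1)^[m] f = 0)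
    (hg : (fwdDiff 1)^[n] g = 0) : (fwdDiff 1)^[m + n] (f * g) = 0 := by
  induction hs : m + n generalizing m n f g with
  | zero =>
    obtain rfl : m = 0 := by omega
    simp_all
  | succ s ih =>
    rcases m with _ | m
    · rw [show f = 0 from hf, zero_mul]
      exact fwdDiff_iter_eq_zero_mono (Nat.zero_le _) rfl
    rcases n with _ | n
    · rw [show g = 0 from hg, mul_zero]
      exact fwdDiff_iter_eq_zero_mono (Nat.zero_le _) rfl
    have leibniz : fwdDiff 1 (f * g) =
        fwdDiff 1 f * g + (f * fwdDiff 1 g + fwdDiff 1 f * fwdDiff 1 g) := by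
      rw [← add_assoc]
      simpa only [smul_eq_mul] using fwdDiff_smul 1 f g
    rw [Function.iterate_succ_apply, leibniz, fwdDiff_iter_add, fwdDiff_iter_add,
      ih (f := fwdDiff 1 f) (m := m) hf hg (by omega),
      ih (g := fwdDiff 1 g) (n := n) hf hg (by omega),
      ih (f := fwdDiff 1 f) (g := fwdDiff 1 g) (m := m) hf
        (fwdDiff_iter_eq_zero_mono (Nat.le_succ n) hg) (by omega), zero_add, zero_add]

/-- The algebra of polynomial sequences, encoded as the sequences annihilated by some iterate of the
difference operator (so that no division by factorials is needed). Such a sequence extends uniquely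
from `ℕ` to the negative integers. -/
def polynomialSeq (K : Type*) [CommRing K] : Subalgebra K (ℕ → K) where
  carrier := {f | ∃ n, (fwdDiff 1)^[n] f = 0}
  mul_mem' := fun ⟨m, hm⟩ ⟨n, hn⟩ => ⟨m + n, fwdDiff_iter_mul_eq_zero hm hn⟩
  add_mem' := fun ⟨m, hm⟩ ⟨n, hn⟩ => ⟨max m n, by
    rw [fwdDiff_iter_add, fwdDiff_iter_eq_zero_mono (le_max_left m n) hm,
      fwdDiff_iter_eq_zero_mono (le_max_right m n) hn, add_zero]⟩
  algebraMap_mem' r := ⟨1, fwdDiff_const 1 r⟩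

theorem eq_zero_of_fwdDiff_iter_eq_zero {f : ℕ → K} {m : ℕ} (hf : (fwdDiff 1)^[m] f = 0)
    (h : ∀ n, f (n + 1) = 0) : f = 0 := by
  induction m generalizing f with
  | zero => exact hf
  | succ m ih =>
    have hdiff : fwdDiff 1 f = 0 := ih hf fun n => by simp [fwdDiff, h]
    funext n
    rcases n with _ | n
    · simpa [fwdDiff, h] using congrFun hdiff 0
    · exact h n

theorem exists_shift_eq {f : ℕ → K} {m : ℕ} (hf : (fwdDiff 1)^[m] f = 0) :
    ∃ g : ℕ → K, (fwdDiff 1)^[m] g = 0 ∧ ∀ n, g (n + 1) = f n := by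
  induction m generalizing f with
  | zero => exact ⟨0, rfl, fun n => (congrFun hf n).symm⟩
  | succ m ih =>
    obtain ⟨g, hg, hgf⟩ := ih hf
    let G : ℕ → K := fun n => n.casesOn (f 0 - g 0) f
    have hG : fwdDiff 1 G = g := by
      funext n
      rcases n with _ | n
      · simp [G, fwdDiff]
      · simp [G, fwdDiff, hgf]
    exact ⟨G, by rw [Function.iterate_succ_apply, hG, hg], fun _ => rfl⟩

namespace polynomialSeq

/-- The shift `n ↦ f (n + 1)` of polynomial sequences. -/
def shift (K : Type*) [CommRing K] : polynomialSeq K →ₐ[K] polynomialSeq K where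
  toFun f := ⟨fun n => f.1 (n + 1), f.2.imp fun m hm => funext fun n => by
    rw [fwdDiff_iter_comp_add, hm]; rfl⟩
  map_one' := rfl
  map_mul' _ _ := rfl
  map_zero' := rfl
  map_add' _ _ := rfl
  commutes' _ := rfl

theorem shift_bijective : Function.Bijective (shift K) := by
  refine ⟨(injective_iff_map_eq_zero _).2 fun f hf => ?_, fun f => ?_⟩
  · obtain ⟨m, hm⟩ := f.2
    exact Subtype.ext (eq_zero_of_fwdDiff_iter_eq_zero hm (congrFun (congrArg Subtype.val hf)))
  · obtain ⟨m, hm⟩ := f.2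
    obtain ⟨g, hg, hgf⟩ := exists_shift_eq hm
    exact ⟨⟨g, m, hg⟩, Subtype.ext (funext hgf)⟩

/-- The value at `-1` of the extension of a polynomial sequence to the integers. -/
noncomputable def evalNegOne (K : Type*) [CommRing K] : polynomialSeq K →ₐ[K] K :=
  ((Pi.evalAlgHom K (fun _ : ℕ => K) 0).comp (polynomialSeq K).val).comp
    (AlgEquiv.ofBijective (shift K) shift_bijective).symm.toAlgHom

theorem evalNegOne_eq {f g : polynomialSeq K} (h : ∀ n, g.1 (n + 1) = f.1 n) :
    evalNegOne K f = g.1 0 := by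
  have hg : (AlgEquiv.ofBijective (shift K) shift_bijective).symm f = g :=
    (AlgEquiv.symm_apply_eq _).2 (Subtype.ext (funext h)).symm
  exact congrFun (congrArg Subtype.val hg) 0

end polynomialSeq

end PolynomialSeq

/-! ### Incidence algebras -/

section Incidence

variable {R S α : Type*} [CommRing R] [CommRing S] [PartialOrder α] [LocallyFiniteOrder α]

theorem incidence_pow_apply_eq_zero [DecidableEq α] {X : IncidenceAlgebra R α} (hX : ∀ a, X a a = 0)
    {n : ℕ} {a b : α} (h : #(Icc a b) ≤ n) : (X ^ n) a b = 0 := by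
  induction n generalizing a with
  | zero =>
    rw [Nat.le_zero, card_eq_zero, Icc_eq_empty_iff] at h
    exact IncidenceAlgebra.apply_eq_zero_of_not_le h _
  | succ n ih =>
    rw [pow_succ', IncidenceAlgebra.mul_apply]
    refine sum_eq_zero fun c hc => ?_
    obtain ⟨hac, hcb⟩ := mem_Icc.1 hc
    obtain rfl | hlt := hac.eq_or_lt
    · rw [hX, zero_mul]
    · have hcard : #(Icc c b) < #(Icc a b) :=
        card_lt_card (Icc_ssubset_Icc_left (hac.trans hcb) hlt le_rfl)
      rw [ih (by omega), mul_zero]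

theorem incidence_isLeftRegular {f : IncidenceAlgebra R α} (hf : ∀ a, f a a = 1) :
    IsLeftRegular f := by
  classical
  refine isLeftRegular_iff_right_eq_zero_of_mul.2 fun Y hY => ?_
  have hfix : ∀ n, Y = (1 - f) ^ n * Y := by
    intro n
    induction n with
    | zero => rw [pow_zero, one_mul]
    | succ n ih => rw [pow_succ, mul_assoc, sub_mul, hY, one_mul, sub_zero, ← ih]
  ext a b _
  rw [hfix #(Icc a b), IncidenceAlgebra.mul_apply, IncidenceAlgebra.zero_apply]
  refine sum_eq_zero fun c hc => ?_
  rw [incidence_pow_apply_eq_zero (fun a => by simp [IncidenceAlgebra.sub_apply, hf])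
    (card_le_card (Icc_subset_Icc_right (mem_Icc.1 hc).2)), zero_mul]

variable [DecidableEq α]

/-- The ring homomorphism of incidence algebras induced by a homomorphism of the coefficients. -/
def incidenceMap (φ : R →+* S) : IncidenceAlgebra R α →+* IncidenceAlgebra S α where
  toFun f := ⟨fun a b => φ (f a b), fun a b h => by
    rw [IncidenceAlgebra.apply_eq_zero_of_not_le h, map_zero]⟩
  map_one' := by
    ext a b _
    simp only [IncidenceAlgebra.coe_mk, IncidenceAlgebra.one_apply]
    split_ifs <;> simp
  map_mul' f g := by
    ext a b _
    simp [IncidenceAlgebra.mul_apply]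
  map_zero' := by
    ext a b _
    simp [IncidenceAlgebra.zero_apply]
  map_add' f g := by
    ext a b _
    simp [IncidenceAlgebra.add_apply]

theorem incidenceMap_apply (φ : R →+* S) (f : IncidenceAlgebra R α) (a b : α) :
    incidenceMap φ f a b = φ (f a b) := rfl

theorem incidence_mul_pow_mem_polynomialSeq {f : IncidenceAlgebra R α} (hf : ∀ a, f a a = 1)
    (g : IncidenceAlgebra R α) (a b : α) : (fun n => (g * f ^ n) a b) ∈ polynomialSeq R := by
  have hdiff : ∀ m, (fwdDiff 1)^[m] (fun n => (g * f ^ n) a b) =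
      fun n => (g * f ^ n * (f - 1) ^ m) a b := by
    intro m
    induction m with
    | zero => simp
    | succ m ih =>
      funext n
      rw [Function.iterate_succ_apply', ih, fwdDiff, ← IncidenceAlgebra.sub_apply, ← sub_mul,
        ← mul_sub, pow_succ' (f - 1) m, pow_succ f n, ← mul_sub_one, mul_assoc, mul_assoc,
        mul_assoc]
  refine ⟨#(Icc a b), funext fun n => (congrFun (hdiff _) n).trans ?_⟩
  rw [IncidenceAlgebra.mul_apply]
  refine sum_eq_zero fun c hc => ?_
  rw [incidence_pow_apply_eq_zero (fun a => by simp [IncidenceAlgebra.sub_apply, hf])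
    (card_le_card (Icc_subset_Icc_left (mem_Icc.1 hc).1)), mul_zero]

theorem incidence_pow_mem_polynomialSeq {f : IncidenceAlgebra R α} (hf : ∀ a, f a a = 1)
    (a b : α) : (fun n => (f ^ n) a b) ∈ polynomialSeq R := by
  simpa only [one_mul] using incidence_mul_pow_mem_polynomialSeq hf 1 a b

theorem evalNegOne_incidence_pow {f g : IncidenceAlgebra R α} (hf : ∀ a, f a a = 1)
    (hgf : g * f = 1) (a b : α) :
    polynomialSeq.evalNegOne R ⟨fun n => (f ^ n) a b, incidence_pow_mem_polynomialSeq hf a b⟩ =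
      g a b := by
  rw [polynomialSeq.evalNegOne_eq (g := ⟨_, incidence_mul_pow_mem_polynomialSeq hf g a b⟩)]
  · simp only [pow_zero, mul_one]
  · intro n
    simp only [pow_succ', ← mul_assoc, hgf, one_mul]

end Incidence

/-! ### Young diagrams and their column lengths -/

noncomputable instance : DecidableEq YoungDiagram := Classical.decEq _

noncomputable instance : DecidableLE YoungDiagram := Classical.decRel _

theorem finite_Iic_youngDiagram (lam : YoungDiagram) : (Set.Iic lam).Finite := by
  refine Set.Finite.of_finite_image (f := YoungDiagram.cells)
    (lam.cells.powerset.finite_toSet.subset ?_) fun a _ b _ h => YoungDiagram.ext h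
  rintro _ ⟨ν, hν, rfl⟩
  simpa using YoungDiagram.cells_subset_iff.2 hν

noncomputable instance : LocallyFiniteOrder YoungDiagram :=
  LocallyFiniteOrder.ofFiniteIcc fun _ lam =>
    (finite_Iic_youngDiagram lam).subset Set.Icc_subset_Iic_self

theorem le_iff_colLen {μ lam : YoungDiagram} : μ ≤ lam ↔ ∀ j, μ.colLen j ≤ lam.colLen j := by
  constructor
  · intro h j
    by_contra! hlt
    exact lt_irrefl _ (YoungDiagram.mem_iff_lt_colLen.1 (h (YoungDiagram.mem_iff_lt_colLen.2 hlt)))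
  · rintro h ⟨i, j⟩ hc
    exact YoungDiagram.mem_iff_lt_colLen.2 ((YoungDiagram.mem_iff_lt_colLen.1 hc).trans_le (h j))

theorem colLen_injective : Function.Injective YoungDiagram.colLen := fun _ _ h =>
  le_antisymm (le_iff_colLen.2 fun j => (congrFun h j).le)
    (le_iff_colLen.2 fun j => (congrFun h j).ge)

theorem colLen_eq_zero {lam : YoungDiagram} {j : ℕ} (h : lam.card ≤ j) : lam.colLen j = 0 := by
  by_contra hpos
  have hsub : (range (j + 1)).map (.sectR 0 ℕ) ⊆ lam.cells := by
    intro c hc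
    obtain ⟨k, hk, rfl⟩ := mem_map.1 hc
    exact lam.up_left_mem le_rfl (Nat.lt_succ_iff.1 (mem_range.1 hk))
      (YoungDiagram.mem_iff_lt_colLen.2 (Nat.pos_of_ne_zero hpos))
  have hcard := card_le_card hsub
  rw [card_map, card_range] at hcard
  exact absurd hcard (by simpa [Nat.lt_succ_iff] using h)

/-- The Young diagram whose columns have the lengths `g 0 ≥ g 1 ≥ ⋯ ≥ g (N - 1)`. -/
def ofColLens (g : ℕ → ℕ) (hg : Antitone g) (N : ℕ) : YoungDiagram where
  cells := (range (g 0) ×ˢ range N).filter fun c => c.1 < g c.2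
  isLowerSet := by
    rintro ⟨i, j⟩ ⟨i', j'⟩ ⟨hi, hj⟩ h
    have := hg hj
    simp_all only [coe_filter, mem_product, mem_range, Set.mem_ofPred_eq]
    omega

theorem colLen_ofColLens {g : ℕ → ℕ} (hg : Antitone g) {N : ℕ} (hN : ∀ j, N ≤ j → g j = 0) :
    (ofColLens g hg N).colLen = g := by
  funext j
  refine eq_of_forall_lt_iff fun i => ?_
  rw [← YoungDiagram.mem_iff_lt_colLen, ← YoungDiagram.mem_cells]
  simp only [ofColLens, mem_filter, mem_product, mem_range, and_iff_right_iff_imp]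
  refine fun h => ⟨h.trans_le (hg j.zero_le), ?_⟩
  by_contra! hj
  simp [hN j hj] at h

theorem sum_prod_colLen {R : Type*} [CommSemiring R] {S : Finset YoungDiagram} {N : ℕ}
    {l u : ℕ → ℕ}
    (hS : ∀ ν, ν ∈ S ↔ ∀ j, l j ≤ ν.colLen j ∧ ν.colLen j ≤ u j) (hul : ∀ j, u (j + 1) ≤ l j)
    (hu : ∀ j, N ≤ j → u j = 0) (hl : ∀ j, N ≤ j → l j = 0) (F : ℕ → ℕ → R) :
    ∑ ν ∈ S, ∏ j ∈ range N, F j (ν.colLen j) =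
      ∏ j ∈ range N, ∑ n ∈ Icc (l j) (u j), F j n := by
  rw [← Fin.prod_univ_eq_prod_range (fun j => ∑ n ∈ Icc (l j) (u j), F j n), prod_univ_sum]
  refine sum_bij (fun ν _ => fun j : Fin N => ν.colLen j) (fun ν hν => ?_)
    (fun ν hν ν' hν' h => colLen_injective (funext fun j => ?_)) (fun p hp => ?_)
    (fun ν _ => (Fin.prod_univ_eq_prod_range (fun j => F j (ν.colLen j)) N).symm)
  · exact Fintype.mem_piFinset.2 fun j => mem_Icc.2 ((hS ν).1 hν j)
  · by_cases hj : j < N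
    · exact congrFun h ⟨j, hj⟩
    · have hν_le := ((hS ν).1 hν j).2
      have hν'_le := ((hS ν').1 hν' j).2
      rw [hu j (not_lt.1 hj)] at hν_le hν'_le
      omega
  · rw [Fintype.mem_piFinset] at hp
    let g : ℕ → ℕ := fun j => if h : j < N then p ⟨j, h⟩ else 0
    have hg : ∀ j, l j ≤ g j ∧ g j ≤ u j := fun j => by
      by_cases h : j < N
      · simpa [g, h] using hp ⟨j, h⟩
      · simp [g, h, hl j (not_lt.1 h)]
    have hanti : Antitone g := antitone_nat_of_succ_le fun j =>
      ((hg (j + 1)).2.trans (hul j)).trans (hg j).1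
    have hcol := colLen_ofColLens hanti (N := N) fun j hj => dif_neg (not_lt.2 hj)
    refine ⟨ofColLens g hanti N, (hS _).2 fun j => by rw [hcol]; exact hg j, ?_⟩
    funext j
    rw [hcol]
    exact dif_pos j.2

section SkewShape

variable {μ lam : YoungDiagram}

theorem mem_skewCells_iff_colLen {c : ℕ × ℕ} :
    c ∈ skewCells lam μ ↔ μ.colLen c.2 ≤ c.1 ∧ c.1 < lam.colLen c.2 := by
  rw [skewCells, mem_sdiff, YoungDiagram.mem_cells, YoungDiagram.mem_cells,
    YoungDiagram.mem_iff_lt_colLen, YoungDiagram.mem_iff_lt_colLen, not_lt, and_comm]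

theorem snd_lt_of_mem_skewCells {N : ℕ} (hN : lam.card ≤ N) {c : ℕ × ℕ}
    (hc : c ∈ skewCells lam μ) : c.2 < N := by
  by_contra! hle
  rw [mem_skewCells_iff_colLen, colLen_eq_zero (hN.trans hle)] at hc
  omega

theorem card_skewCells_eq_sum {N : ℕ} (hN : lam.card ≤ N) :
    #(skewCells lam μ) = ∑ j ∈ range N, (lam.colLen j - μ.colLen j) := by
  rw [card_eq_sum_card_fiberwise (f := Prod.snd) (t := range N)
    fun c hc => mem_coe.2 (mem_range.2 (snd_lt_of_mem_skewCells hN hc))]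
  refine sum_congr rfl fun j _ => ?_
  rw [← Nat.card_Ico, ← card_map (s := Ico _ _) (.sectL ℕ j)]
  congr 1
  ext ⟨i, j'⟩
  simp only [mem_filter, mem_skewCells_iff_colLen, mem_map, mem_Ico, Function.Embedding.sectL_apply,
    Prod.mk.injEq]
  constructor
  · rintro ⟨h, rfl⟩
    exact ⟨i, h, rfl, rfl⟩
  · rintro ⟨i, h, rfl, rfl⟩
    exact ⟨h, rfl⟩

theorem numCols_eq_card_filter {N : ℕ} (hN : lam.card ≤ N) :
    numCols lam μ = #{j ∈ range N | μ.colLen j < lam.colLen j} := by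
  rw [numCols]
  congr 1
  ext j
  simp only [mem_image, mem_filter, mem_range]
  constructor
  · rintro ⟨c, hc, rfl⟩
    have := mem_skewCells_iff_colLen.1 hc
    exact ⟨snd_lt_of_mem_skewCells hN hc, by omega⟩
  · rintro ⟨-, hlt⟩
    exact ⟨(μ.colLen j, j), mem_skewCells_iff_colLen.2 ⟨le_rfl, hlt⟩, rfl⟩

theorem isVerticalStrip_iff_colLen :
    IsVerticalStrip lam μ ↔ ∀ j, lam.colLen (j + 1) ≤ μ.colLen j := by
  constructor
  · intro h j
    by_contra! hlt
    have hlam := lam.colLen_anti j (j + 1) (by omega)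
    have hμ := μ.colLen_anti j (j + 1) (by omega)
    simpa using h (μ.colLen j, j) (mem_skewCells_iff_colLen.2 ⟨le_rfl, hlt.trans_le hlam⟩)
      (μ.colLen j, j + 1) (mem_skewCells_iff_colLen.2 ⟨hμ, hlt⟩) rfl
  · intro h
    have hle : ∀ {i j j' : ℕ}, (i, j) ∈ skewCells lam μ → (i, j') ∈ skewCells lam μ → j' ≤ j := by
      intro i j j' hj hj'
      by_contra! hlt
      exact absurd ((mem_skewCells_iff_colLen.1 hj').2.trans_le
        ((lam.colLen_anti _ _ hlt).trans (h j))) (mem_skewCells_iff_colLen.1 hj).1.not_gt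
    rintro ⟨i, j⟩ hj ⟨i', j'⟩ hj' (rfl : i = i')
    exact Prod.ext rfl (le_antisymm (hle hj' hj) (hle hj hj'))

end SkewShape

/-! ### Strip operators -/

section StripOperators

open PowerSeries (C X coeff)

variable {R : Type*} [CommRing R]

/-- The weight of a column with `n` boxes: `1` if the column is empty, and `a * b ^ (n - 1)`
otherwise. -/
def weight (a b : R) (n : ℕ) : R := a ^ min n 1 * b ^ (n - 1)

theorem weight_zero (a b : R) : weight a b 0 = 1 := by simp [weight]

theorem weight_succ (a b : R) (n : ℕ) : weight a b (n + 1) = a * b ^ n := by simp [weight]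

/-- The product of the weights of the columns of a skew shape. -/
def skewWeight (a b : R) (lam μ : YoungDiagram) : R :=
  a ^ numCols lam μ * b ^ (#(skewCells lam μ) - numCols lam μ)

theorem skewWeight_self (a b : R) (μ : YoungDiagram) : skewWeight a b μ μ = 1 := by
  simp [skewWeight, numCols, skewCells]

theorem skewWeight_eq_prod (a b : R) {lam μ : YoungDiagram} {N : ℕ} (hN : lam.card ≤ N) :
    skewWeight a b lam μ = ∏ j ∈ range N, weight a b (lam.colLen j - μ.colLen j) := by
  have hcols : numCols lam μ = ∑ j ∈ range N, min (lam.colLen j - μ.colLen j) 1 := by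
    rw [numCols_eq_card_filter hN, card_filter]
    refine sum_congr rfl fun j _ => ?_
    split_ifs <;> omega
  have hcells : #(skewCells lam μ) =
      numCols lam μ + ∑ j ∈ range N, (lam.colLen j - μ.colLen j - 1) := by
    rw [card_skewCells_eq_sum hN, hcols, ← sum_add_distrib]
    exact sum_congr rfl fun j _ => by omega
  simp only [skewWeight, weight, prod_mul_distrib, prod_pow_eq_pow_sum, hcells,
    Nat.add_sub_cancel_left]
  rw [hcols]

/-- The geometric series `∑ b ^ n X ^ n = 1 / (1 - b X)`. -/
def geomSeries (b : R) : PowerSeries R := PowerSeries.mk fun n => b ^ n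

theorem one_sub_mul_geomSeries (b : R) : (1 - C b * X) * geomSeries b = 1 := by
  ext n
  rcases n with _ | n
  · simp [geomSeries, sub_mul, mul_assoc]
  · simp [geomSeries, sub_mul, mul_assoc, PowerSeries.coeff_succ_X_mul, PowerSeries.coeff_one,
      pow_succ']

theorem weight_add (a b : R) (p m : ℕ) :
    weight a b (p + m) =
      weight a b p * coeff m ((if p = 0 then 1 - C (b - a) * X else 1) * geomSeries b) := by
  rcases p with _ | p
  · rcases m with _ | m
    · simp [weight_zero, geomSeries, sub_mul, mul_assoc]
    · simp [weight_zero, weight_succ, geomSeries, sub_mul, mul_assoc,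
        PowerSeries.coeff_succ_X_mul, pow_succ']
  · simp [weight_succ, geomSeries, Nat.succ_add, pow_add, mul_assoc]

theorem weight_eq_coeff (a b : R) (n : ℕ) :
    weight a b n = coeff n ((1 - C (b - a) * X) * geomSeries b) := by
  simpa [weight_zero] using weight_add a b 0 n

theorem sum_Icc_coeff_mul_coeff (P Q : PowerSeries R) {l u : ℕ} (h : l ≤ u) :
    ∑ n ∈ Icc l u, coeff (n - l) P * coeff (u - n) Q = coeff (u - l) (P * Q) := by
  rw [PowerSeries.coeff_mul, Nat.sum_antidiagonal_eq_sum_range_succ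
    (fun i j => coeff i P * coeff j Q), ← Ico_add_one_right_eq_Icc, sum_Ico_eq_sum_range,
    Nat.succ_eq_add_one, ← Nat.sub_add_comm h]
  exact sum_congr rfl fun k _ => by rw [Nat.add_sub_cancel_left, Nat.sub_add_eq]

/-- The operator on Young diagrams that adds an arbitrary skew shape, weighted by `x s ^ (n - 1)`
for each column of `n > 0` boxes. It adds one variable `x` to the dual stable Grothendieck
polynomials (for `s = 1`) and to the Schur functions (for `s = 0`, when only horizontal strips have
a nonzero weight). -/
noncomputable def colOp (s x : R) : IncidenceAlgebra R YoungDiagram :=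
  ⟨fun μ lam => if μ ≤ lam then skewWeight x s lam μ else 0, fun _ _ h => if_neg h⟩

/-- The operator on Young diagrams that adds a vertical strip, weighted by `t (t + s) ^ (n - 1)` for
each column of `n > 0` boxes. -/
noncomputable def vertOp (s t : R) : IncidenceAlgebra R YoungDiagram :=
  ⟨fun μ lam => if μ ≤ lam ∧ IsVerticalStrip lam μ then skewWeight t (t + s) lam μ else 0,
    fun _ _ h => if_neg fun h' => h h'.1⟩

theorem colOp_apply (s x : R) {μ lam : YoungDiagram} (h : μ ≤ lam) :
    colOp s x μ lam = skewWeight x s lam μ := if_pos h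

theorem vertOp_apply (s t : R) {μ lam : YoungDiagram} (h : μ ≤ lam) :
    vertOp s t μ lam = if IsVerticalStrip lam μ then skewWeight t (t + s) lam μ else 0 := by
  simp [vertOp, h]

theorem colOp_apply_self (s x : R) (μ : YoungDiagram) : colOp s x μ μ = 1 := by
  rw [colOp_apply s x le_rfl, skewWeight_self]

theorem vertOp_apply_self (s t : R) (μ : YoungDiagram) : vertOp s t μ μ = 1 := by
  rw [vertOp_apply s t le_rfl, skewWeight_self, if_pos]
  simp [IsVerticalStrip, skewCells]

/-- The largest possible length of column `j` of a diagram `ν ≤ lam` such that `ν / μ` is a vertical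
strip. -/
def stripBound (μ lam : YoungDiagram) : ℕ → ℕ
  | 0 => lam.colLen 0
  | j + 1 => min (lam.colLen (j + 1)) (μ.colLen j)

theorem stripBound_le (μ lam : YoungDiagram) (j : ℕ) : stripBound μ lam j ≤ lam.colLen j := by
  rcases j with _ | j
  · exact le_rfl
  · exact min_le_left _ _

theorem stripBound_succ_le (μ lam : YoungDiagram) (j : ℕ) :
    stripBound μ lam (j + 1) ≤ μ.colLen j := min_le_right _ _

theorem le_and_isVerticalStrip_iff {μ ν lam : YoungDiagram} :
    ν ≤ lam ∧ IsVerticalStrip ν μ ↔ ∀ j, ν.colLen j ≤ stripBound μ lam j := by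
  rw [le_iff_colLen, isVerticalStrip_iff_colLen]
  constructor
  · rintro ⟨hle, hvert⟩ (_ | j)
    · exact hle 0
    · exact le_min (hle _) (hvert j)
  · exact fun h => ⟨fun j => (h j).trans (stripBound_le _ _ j),
      fun j => (h (j + 1)).trans (stripBound_succ_le _ _ j)⟩

theorem stripBound_eq_zero {μ lam : YoungDiagram} {j : ℕ} (h : lam.card ≤ j) :
    stripBound μ lam j = 0 :=
  Nat.le_zero.1 ((stripBound_le μ lam j).trans (colLen_eq_zero h).le)

theorem vertOp_mul_colOp_apply (s t x : R) {μ lam : YoungDiagram} (h : μ ≤ lam) :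
    (vertOp s t * colOp s x) μ lam =
      ∏ j ∈ range lam.card, ∑ n ∈ Icc (μ.colLen j) (stripBound μ lam j),
        weight t (t + s) (n - μ.colLen j) * weight x s (lam.colLen j - n) := by
  rw [IncidenceAlgebra.mul_apply, ← sum_prod_colLen
    (S := (Icc μ lam).filter fun ν => IsVerticalStrip ν μ), sum_filter]
  · refine sum_congr rfl fun ν hν => ?_
    obtain ⟨hμν, hνlam⟩ := mem_Icc.1 hν
    rw [vertOp_apply s t hμν, colOp_apply s x hνlam, ite_mul, zero_mul]
    refine if_congr Iff.rfl ?_ rfl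
    rw [skewWeight_eq_prod t _ (card_le_card hνlam), skewWeight_eq_prod x s le_rfl,
      prod_mul_distrib]
  · intro ν
    rw [mem_filter, mem_Icc, and_assoc, le_and_isVerticalStrip_iff, le_iff_colLen, forall_and]
  · exact stripBound_succ_le μ lam
  · exact fun j => stripBound_eq_zero
  · exact fun j hj => Nat.le_zero.1 ((le_iff_colLen.1 h j).trans (colLen_eq_zero hj).le)

theorem weightSeries_mul_eq_one (s t : R) :
    ((1 - C (t + s - t) * X) * geomSeries (t + s)) * ((1 - C (s - -t) * X) * geomSeries s) = 1 := by
  rw [add_sub_cancel_left, sub_neg_eq_add, add_comm s t, mul_mul_mul_comm, mul_comm (1 - C s * X),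
    mul_mul_mul_comm, one_sub_mul_geomSeries, one_mul, one_sub_mul_geomSeries]

theorem vertOp_mul_colOp_neg (s t : R) : vertOp s t * colOp s (-t) = 1 := by
  ext μ lam h
  rw [IncidenceAlgebra.one_apply]
  split_ifs with heq
  · subst heq
    simp [IncidenceAlgebra.mul_apply, vertOp_apply_self, colOp_apply_self]
  · have hne : ∃ j, μ.colLen j ≠ lam.colLen j := by
      by_contra! hall
      exact heq (colLen_injective (funext hall))
    classical
    have hlt : μ.colLen (Nat.find hne) < lam.colLen (Nat.find hne) :=
      (le_iff_colLen.1 h _).lt_of_ne (Nat.find_spec hne)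
    have hbound : stripBound μ lam (Nat.find hne) = lam.colLen (Nat.find hne) := by
      rcases hj : Nat.find hne with _ | j
      · rfl
      · have hj' := not_not.1 (Nat.find_min hne (j.lt_succ_self.trans_eq hj.symm))
        exact min_eq_left (hj' ▸ lam.colLen_anti _ _ j.le_succ)
    rw [vertOp_mul_colOp_apply s t (-t) h]
    refine prod_eq_zero (i := Nat.find hne) (mem_range.2 ?_) ?_
    · by_contra! hle
      rw [colLen_eq_zero hle] at hlt
      exact Nat.not_lt_zero _ hlt
    · simp only [weight_eq_coeff, hbound]
      rw [sum_Icc_coeff_mul_coeff _ _ hlt.le, weightSeries_mul_eq_one, PowerSeries.coeff_one,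
        if_neg (Nat.sub_ne_zero_of_lt hlt)]

theorem sum_Icc_weight_mul_weight (s t t' : R) (p q l u : ℕ) :
    ∑ n ∈ Icc l u, weight t (t + s) (p + (n - l)) * weight t' (t' + s) (q + (u - n)) =
      weight t (t + s) p * weight t' (t' + s) q * if l ≤ u then
        coeff (u - l) ((if p = 0 then 1 - C s * X else 1) * (if q = 0 then 1 - C s * X else 1) *
          (geomSeries (t + s) * geomSeries (t' + s))) else 0 := by
  by_cases h : l ≤ u
  · rw [if_pos h, mul_mul_mul_comm (if p = 0 then _ else _),
      ← sum_Icc_coeff_mul_coeff _ _ h, mul_sum]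
    refine sum_congr rfl fun n _ => ?_
    rw [weight_add, weight_add, add_sub_cancel_left, add_sub_cancel_left, mul_mul_mul_comm]
  · rw [if_neg h, Icc_eq_empty h, sum_empty, mul_zero]

theorem vertOp_mul_vertOp_apply (s t t' : R) {μ lam : YoungDiagram} (h : μ ≤ lam) :
    (vertOp s t * vertOp s t') μ lam =
      ∏ j ∈ range lam.card,
        ∑ n ∈ Icc (max (μ.colLen j) (lam.colLen (j + 1))) (stripBound μ lam j),
          weight t (t + s) (n - μ.colLen j) * weight t' (t' + s) (lam.colLen j - n) := by
  rw [IncidenceAlgebra.mul_apply, ← sum_prod_colLen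
    (S := (Icc μ lam).filter fun ν => IsVerticalStrip ν μ ∧ IsVerticalStrip lam ν), sum_filter]
  · refine sum_congr rfl fun ν hν => ?_
    obtain ⟨hμν, hνlam⟩ := mem_Icc.1 hν
    rw [vertOp_apply s t hμν, vertOp_apply s t' hνlam, ite_zero_mul_ite_zero]
    refine if_congr Iff.rfl ?_ rfl
    rw [skewWeight_eq_prod t _ (card_le_card hνlam), skewWeight_eq_prod t' _ le_rfl,
      prod_mul_distrib]
  · intro ν
    simp only [max_le_iff, forall_and, ← le_and_isVerticalStrip_iff, ← le_iff_colLen,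
      ← isVerticalStrip_iff_colLen, mem_filter, mem_Icc]
    tauto
  · exact fun j => (stripBound_succ_le μ lam j).trans (le_max_left _ _)
  · exact fun j => stripBound_eq_zero
  · exact fun j hj => Nat.le_zero.1 (max_le ((le_iff_colLen.1 h j).trans (colLen_eq_zero hj).le)
      (colLen_eq_zero (hj.trans j.le_succ)).le)

theorem prod_weight_sub_stripBound (a b : R) (μ lam : YoungDiagram) :
    ∏ j ∈ range lam.card, weight a b (lam.colLen j - stripBound μ lam j) =
      ∏ j ∈ range lam.card, weight a b (lam.colLen (j + 1) - μ.colLen j) := by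
  have hfirst : weight a b (lam.colLen 0 - stripBound μ lam 0) = 1 := by
    rw [stripBound, Nat.sub_self, weight_zero]
  have hlast : weight a b (lam.colLen lam.card - stripBound μ lam lam.card) = 1 := by
    rw [colLen_eq_zero le_rfl, Nat.zero_sub, weight_zero]
  have hshift := prod_range_succ' (fun j => weight a b (lam.colLen j - stripBound μ lam j)) lam.card
  rw [prod_range_succ, hfirst, hlast, mul_one, mul_one] at hshift
  rw [hshift]
  refine prod_congr rfl fun j _ => congrArg _ ?_
  rw [stripBound]
  omega

theorem vertOp_commute (s t t' : R) : Commute (vertOp s t) (vertOp s t') := by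
  ext μ lam h
  have hfactor : ∀ x x', (vertOp s x * vertOp s x') μ lam = ∏ j ∈ range lam.card,
      ∑ n ∈ Icc (max (μ.colLen j) (lam.colLen (j + 1))) (stripBound μ lam j),
        weight x (x + s) (lam.colLen (j + 1) - μ.colLen j +
          (n - max (μ.colLen j) (lam.colLen (j + 1)))) *
        weight x' (x' + s) (lam.colLen j - stripBound μ lam j + (stripBound μ lam j - n)) := by
    intro x x'
    rw [vertOp_mul_vertOp_apply s x x' h]
    refine prod_congr rfl fun j _ => sum_congr rfl fun n hn => ?_
    have := stripBound_le μ lam j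
    rw [mem_Icc, max_le_iff] at hn
    congr 2 <;> omega
  simp only [hfactor, sum_Icc_weight_mul_weight, prod_mul_distrib, prod_weight_sub_stripBound,
    mul_comm (geomSeries (t + s)), mul_comm (∏ _ ∈ range lam.card, weight t (t + s) _)]

theorem colOp_commute (s x x' : R) : Commute (colOp s x) (colOp s x') := by
  have hreg : IsLeftRegular (vertOp s (-x') * vertOp s (-x)) := incidence_isLeftRegular fun μ => by
    simp [IncidenceAlgebra.mul_apply, vertOp_apply_self]
  have hinv : ∀ x, vertOp s (-x) * colOp s x = 1 := fun x => by
    simpa only [neg_neg] using vertOp_mul_colOp_neg s (-x)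
  have hcancel : ∀ x x', vertOp s (-x') * vertOp s (-x) * (colOp s x * colOp s x') = 1 := by
    intro x x'
    rw [mul_assoc, ← mul_assoc (vertOp s (-x)), hinv, one_mul, hinv]
  refine hreg ((hcancel x x').trans ?_)
  dsimp only
  rw [(vertOp_commute s (-x') (-x)).eq, hcancel]

end StripOperators

/-! ### Counting reverse plane partitions -/

theorem mem_skewCells {lam μ : YoungDiagram} {c : ℕ × ℕ} :
    c ∈ skewCells lam μ ↔ c ∈ lam ∧ c ∉ μ := by
  rw [skewCells, mem_sdiff, YoungDiagram.mem_cells, YoungDiagram.mem_cells]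

namespace ReversePlanePartition

variable {lam μ ν : YoungDiagram}

theorem entry_mono (T : ReversePlanePartition lam μ) {i j i' j' : ℕ} (hi : i ≤ i') (hj : j ≤ j')
    (h₁ : (i, j) ∈ skewCells lam μ) (h₂ : (i', j') ∈ skewCells lam μ) :
    T.entry i j ≤ T.entry i' j' := by
  have hcorner : (i, j') ∈ skewCells lam μ := mem_skewCells.2
    ⟨lam.up_left_mem hi le_rfl (mem_skewCells.1 h₂).1,
      fun hc => (mem_skewCells.1 h₁).2 (μ.up_left_mem le_rfl hj hc)⟩
  calc T.entry i j ≤ T.entry i j' := by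
        rcases hj.eq_or_lt with rfl | hlt
        exacts [le_rfl, T.row_weak hlt h₁ hcorner]
    _ ≤ T.entry i' j' := by
        rcases hi.eq_or_lt with rfl | hlt
        exacts [le_rfl, T.col_weak hlt hcorner h₂]

/-- The diagram formed by the boxes of `lam` that lie in `μ` or have an entry less than `k`. -/
def sub (T : ReversePlanePartition lam μ) (k : ℕ) : YoungDiagram where
  cells := lam.cells.filter fun c => c ∈ μ ∨ T.entry c.1 c.2 < k
  isLowerSet := by
    rintro ⟨i, j⟩ ⟨i', j'⟩ ⟨hi, hj⟩ h
    simp only [coe_filter, Set.mem_ofPred_eq, YoungDiagram.mem_cells] at h ⊢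
    refine ⟨lam.up_left_mem hi hj h.1, ?_⟩
    by_contra! hc
    have hμ : (i, j) ∉ μ := fun hmem => hc.1 (μ.up_left_mem hi hj hmem)
    have hmono := T.entry_mono hi hj (mem_skewCells.2 ⟨lam.up_left_mem hi hj h.1, hc.1⟩)
      (mem_skewCells.2 ⟨h.1, hμ⟩)
    exact absurd (h.2.resolve_left hμ) (not_lt.2 (hc.2.trans hmono))

theorem mem_sub {T : ReversePlanePartition lam μ} {k : ℕ} {c : ℕ × ℕ} :
    c ∈ T.sub k ↔ c ∈ lam ∧ (c ∈ μ ∨ T.entry c.1 c.2 < k) := by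
  rw [← YoungDiagram.mem_cells, sub, mem_filter, YoungDiagram.mem_cells]

theorem sub_mem_Icc (h : μ ≤ lam) (T : ReversePlanePartition lam μ) (k : ℕ) :
    T.sub k ∈ Icc μ lam :=
  mem_Icc.2 ⟨fun _ hc => mem_sub.2 ⟨h hc, Or.inl hc⟩, fun _ hc => (mem_sub.1 hc).1⟩

/-- The restriction of a reverse plane partition to a smaller outer shape. -/
def restrict (T : ReversePlanePartition lam μ) (h : ν ≤ lam) : ReversePlanePartition ν μ where
  entry i j := if (i, j) ∈ ν then T.entry i j else 0
  row_weak hj h₁ h₂ := by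
    rw [mem_skewCells] at h₁ h₂
    rw [if_pos h₁.1, if_pos h₂.1]
    exact T.row_weak hj (mem_skewCells.2 ⟨h h₁.1, h₁.2⟩) (mem_skewCells.2 ⟨h h₂.1, h₂.2⟩)
  col_weak hi h₁ h₂ := by
    rw [mem_skewCells] at h₁ h₂
    rw [if_pos h₁.1, if_pos h₂.1]
    exact T.col_weak hi (mem_skewCells.2 ⟨h h₁.1, h₁.2⟩) (mem_skewCells.2 ⟨h h₂.1, h₂.2⟩)
  zeros hc := by
    rw [mem_skewCells, not_and_not_right] at hc
    split_ifs with hν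
    · exact T.zeros fun h' => (mem_skewCells.1 h').2 (hc hν)
    · rfl

/-- The extension of a reverse plane partition with entries less than `N` to a larger outer shape by
entries equal to `N`. -/
def extend (T : ReversePlanePartition ν μ) (h : ν ≤ lam) (hμ : μ ≤ ν) (N : ℕ)
    (hN : ∀ i j, (i, j) ∈ skewCells ν μ → T.entry i j < N) : ReversePlanePartition lam μ where
  entry i j := if (i, j) ∈ ν then T.entry i j else if (i, j) ∈ lam then N else 0
  row_weak {i j₁ j₂} hj h₁ h₂ := by
    rw [mem_skewCells] at h₁ h₂
    rw [if_pos h₁.1, if_pos h₂.1]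
    have hT₁ (hν : (i, j₁) ∈ ν) := mem_skewCells.2 ⟨hν, h₁.2⟩
    split_ifs with hν₁ hν₂ hν₂
    · exact T.row_weak hj (hT₁ hν₁) (mem_skewCells.2 ⟨hν₂, h₂.2⟩)
    · exact (hN _ _ (hT₁ hν₁)).le
    · exact absurd (ν.up_left_mem le_rfl hj.le hν₂) hν₁
    · exact le_rfl
  col_weak {i₁ i₂ j} hi h₁ h₂ := by
    rw [mem_skewCells] at h₁ h₂
    rw [if_pos h₁.1, if_pos h₂.1]
    have hT₁ (hν : (i₁, j) ∈ ν) := mem_skewCells.2 ⟨hν, h₁.2⟩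
    split_ifs with hν₁ hν₂ hν₂
    · exact T.col_weak hi (hT₁ hν₁) (mem_skewCells.2 ⟨hν₂, h₂.2⟩)
    · exact (hN _ _ (hT₁ hν₁)).le
    · exact absurd (ν.up_left_mem hi.le le_rfl hν₂) hν₁
    · exact le_rfl
  zeros {i j} hc := by
    rw [mem_skewCells, not_and_not_right] at hc
    split_ifs with hν hlam
    · exact T.zeros fun h' => (mem_skewCells.1 h').2 (hc (h hν))
    · exact absurd (hμ (hc hlam)) hν
    · rfl

section Extend

variable {T : ReversePlanePartition ν μ} (h : ν ≤ lam) (hμ : μ ≤ ν) {N : ℕ}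
  (hN : ∀ i j, (i, j) ∈ skewCells ν μ → T.entry i j < N)

theorem restrict_extend : (T.extend h hμ N hN).restrict h = T := by
  ext i j
  simp only [restrict, extend]
  split_ifs with hν
  · rfl
  · exact (T.zeros fun hc => hν (mem_skewCells.1 hc).1).symm

theorem sub_extend : (T.extend h hμ N hN).sub N = ν := by
  ext ⟨i, j⟩
  simp only [YoungDiagram.mem_cells, mem_sub, extend]
  by_cases hν : (i, j) ∈ ν
  · simp only [hν, h hν, if_true, true_and, iff_true, or_iff_not_imp_left]
    exact fun hc => hN i j (mem_skewCells.2 ⟨hν, hc⟩)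
  · simp +contextual [hν, mt (@hμ (i, j)) hν]

theorem colCount_extend_self : (T.extend h hμ N hN).colCount N = numCols lam ν := by
  rw [colCount, numCols]
  congr 2
  ext ⟨i, j⟩
  rw [mem_filter, mem_skewCells, mem_skewCells]
  simp only [extend]
  by_cases hν : (i, j) ∈ ν
  · simpa [hν] using fun _ hc => (hN i j (mem_skewCells.2 ⟨hν, hc⟩)).ne
  · have : (i, j) ∉ μ := fun hc => hν (hμ hc)
    simp +contextual [hν, this]

theorem colCount_extend_of_ne {k : ℕ} (hk : k ≠ N) :
    (T.extend h hμ N hN).colCount k = T.colCount k := by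
  rw [colCount, colCount]
  congr 2
  ext ⟨i, j⟩
  rw [mem_filter, mem_filter, mem_skewCells, mem_skewCells]
  simp only [extend]
  by_cases hν : (i, j) ∈ ν
  · simp [hν, h hν]
  · simp +contextual [hν, hk.symm]

end Extend

theorem restrict_entry_lt {T : ReversePlanePartition lam μ} {N : ℕ} (hT : T.sub N = ν)
    (h : ν ≤ lam) (i j : ℕ) (hc : (i, j) ∈ skewCells ν μ) : (T.restrict h).entry i j < N := by
  subst hT
  rw [mem_skewCells] at hc
  simpa [restrict, hc.1] using (mem_sub.1 hc.1).2.resolve_left hc.2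

theorem extend_restrict {T : ReversePlanePartition lam μ} {N : ℕ} (hT : T.sub N = ν) (h : ν ≤ lam)
    (hμ : μ ≤ ν) (hN : ∀ i j, (i, j) ∈ skewCells lam μ → T.entry i j ≤ N) :
    (T.restrict h).extend h hμ N (restrict_entry_lt hT h) = T := by
  ext i j
  simp only [restrict, extend]
  split_ifs with hν hlam
  · rfl
  · rw [← hT, mem_sub, not_and, not_or, not_lt] at hν
    exact le_antisymm (hν hlam).2 (hN i j (mem_skewCells.2 ⟨hlam, (hν hlam).1⟩))
  · exact (T.zeros fun hc => hlam (mem_skewCells.1 hc).1).symm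

theorem colCount_eq_zero_iff {T : ReversePlanePartition lam μ} {k : ℕ} :
    T.colCount k = 0 ↔ ∀ i j, (i, j) ∈ skewCells lam μ → T.entry i j ≠ k := by
  rw [colCount, card_eq_zero, image_eq_empty, filter_eq_empty_iff, Prod.forall]

theorem entry_mem_support {T : ReversePlanePartition lam μ} {d : ℕ →₀ ℕ}
    (hT : ∀ k, T.colCount k = d k) {i j : ℕ} (hc : (i, j) ∈ skewCells lam μ) :
    T.entry i j ∈ d.support := by
  rw [Finsupp.mem_support_iff, ← hT]
  exact fun h => colCount_eq_zero_iff.1 h i j hc rfl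

instance finite_colCount_eq (lam μ : YoungDiagram) (d : ℕ →₀ ℕ) :
    Finite {T : ReversePlanePartition lam μ // ∀ k, T.colCount k = d k} := by
  refine Finite.of_injective
    (fun T (c : skewCells lam μ) => (⟨_, T.1.entry_mem_support T.2 c.2⟩ : d.support))
    fun T T' h => Subtype.ext (ReversePlanePartition.ext ?_)
  funext i j
  by_cases hc : (i, j) ∈ skewCells lam μ
  · exact congrArg Subtype.val (congrFun h ⟨(i, j), hc⟩)
  · rw [T.1.zeros hc, T'.1.zeros hc]

theorem sum_card_filter_eq {T : ReversePlanePartition lam μ} {d : ℕ →₀ ℕ}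
    (hT : ∀ k, T.colCount k = d k) :
    ∑ k ∈ d.support, #{c ∈ skewCells lam μ | T.entry c.1 c.2 = k} = #(skewCells lam μ) :=
  (card_eq_sum_card_fiberwise fun _ hc => entry_mem_support hT hc).symm

theorem degree_le_of_colCount_eq {T : ReversePlanePartition lam μ} {d : ℕ →₀ ℕ}
    (hT : ∀ k, T.colCount k = d k) : d.degree ≤ #(skewCells lam μ) := by
  rw [Finsupp.degree_apply, ← sum_card_filter_eq hT]
  exact sum_le_sum fun k _ => (hT k).symm.le.trans card_image_le

end ReversePlanePartition

/-- The number of reverse plane partitions of shape `lam / μ` in which `d k` columns contain the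
entry `k`, for every `k`. -/
noncomputable def rppCount (lam μ : YoungDiagram) (d : ℕ →₀ ℕ) : ℕ :=
  Nat.card {T : ReversePlanePartition lam μ // ∀ k, T.colCount k = d k}

section RppCount

open ReversePlanePartition

variable {lam μ : YoungDiagram}

theorem degree_le_of_rppCount_ne_zero {d : ℕ →₀ ℕ} (h : rppCount lam μ d ≠ 0) :
    d.degree ≤ #(skewCells lam μ) := by
  obtain ⟨⟨T, hT⟩⟩ := (Nat.card_ne_zero.1 h).1
  exact degree_le_of_colCount_eq hT

theorem colCount_eq_numCols_sub {T : ReversePlanePartition lam μ} {N : ℕ} (h : μ ≤ lam)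
    (hN : ∀ i j, (i, j) ∈ skewCells lam μ → T.entry i j ≤ N) :
    T.colCount N = numCols lam (T.sub N) := by
  obtain ⟨hμ, hlam⟩ := mem_Icc.1 (T.sub_mem_Icc h N)
  conv_lhs => rw [← extend_restrict rfl hlam hμ hN]
  exact colCount_extend_self hlam hμ _

/-- Removing the boxes with the largest possible entry `N` from a reverse plane partition. -/
def subEquiv {ν : YoungDiagram} (hμν : μ ≤ ν) (hνlam : ν ≤ lam) {d : ℕ →₀ ℕ} {N : ℕ}
    (hd : ∀ k ∈ d.support, k ≤ N) (hN : numCols lam ν = d N) :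
    {T : {T : ReversePlanePartition lam μ // ∀ k, T.colCount k = d k} // T.1.sub N = ν} ≃
      {T : ReversePlanePartition ν μ // ∀ k, T.colCount k = d.erase N k} :=
  have hle (T : {T : ReversePlanePartition lam μ // ∀ k, T.colCount k = d k}) (i j : ℕ)
      (hc : (i, j) ∈ skewCells lam μ) : T.1.entry i j ≤ N := hd _ (entry_mem_support T.2 hc)
  have hlt (T : {T : ReversePlanePartition ν μ // ∀ k, T.colCount k = d.erase N k}) (i j : ℕ)
      (hc : (i, j) ∈ skewCells ν μ) : T.1.entry i j < N := by
    have hmem := entry_mem_support T.2 hc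
    rw [Finsupp.support_erase, mem_erase] at hmem
    exact (hd _ hmem.2).lt_of_ne hmem.1
  { toFun T := ⟨T.1.1.restrict hνlam, fun k => by
      rcases eq_or_ne k N with rfl | hk
      · rw [Finsupp.erase_same, colCount_eq_zero_iff]
        exact fun i j hc => (restrict_entry_lt T.2 hνlam i j hc).ne
      · have hcount := colCount_extend_of_ne hνlam hμν (restrict_entry_lt T.2 hνlam) hk
        rw [extend_restrict T.2 hνlam hμν (hle T.1)] at hcount
        rw [Finsupp.erase_ne hk, ← T.1.2, hcount]⟩
    invFun T := ⟨⟨T.1.extend hνlam hμν N (hlt T), fun k => by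
      rcases eq_or_ne k N with rfl | hk
      · rw [colCount_extend_self, hN]
      · rw [colCount_extend_of_ne _ _ _ hk, T.2, Finsupp.erase_ne hk]⟩,
      sub_extend hνlam hμν (hlt T)⟩
    left_inv T := Subtype.ext (Subtype.ext (extend_restrict T.2 hνlam hμν (hle T.1)))
    right_inv T := Subtype.ext (restrict_extend hνlam hμν (hlt T)) }

theorem rppCount_eq_sum (h : μ ≤ lam) {d : ℕ →₀ ℕ} {N : ℕ} (hd : ∀ k ∈ d.support, k ≤ N) :
    rppCount lam μ d =
      ∑ ν ∈ Icc μ lam, if numCols lam ν = d N then rppCount ν μ (d.erase N) else 0 := by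
  let f (T : {T : ReversePlanePartition lam μ // ∀ k, T.colCount k = d k}) : Icc μ lam :=
    ⟨T.1.sub N, T.1.sub_mem_Icc h N⟩
  rw [rppCount, ← Nat.card_congr (Equiv.sigmaFiberEquiv f), Nat.card_sigma,
    ← sum_coe_sort (Icc μ lam)]
  refine sum_congr rfl fun ν _ => ?_
  obtain ⟨hμν, hνlam⟩ := mem_Icc.1 ν.2
  rw [Nat.card_congr (Equiv.subtypeEquivRight fun T => Subtype.ext_iff)]
  split_ifs with hN
  · exact Nat.card_congr (subEquiv hμν hνlam hd hN)
  · refine Nat.card_eq_zero.2 (.inl ⟨fun ⟨T, hT⟩ => hN ?_⟩)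
    rw [← hT, ← T.2, colCount_eq_numCols_sub h fun i j hc => hd _ (entry_mem_support T.2 hc)]

theorem rppCount_self (μ : YoungDiagram) : rppCount μ μ 0 = 1 := by
  have hempty (i j : ℕ) : (i, j) ∉ skewCells μ μ := by simp [skewCells]
  refine Nat.card_eq_one_iff_unique.2 ⟨⟨fun T T' => ?_⟩, ⟨⟨⟨0, ?_, ?_, ?_⟩, ?_⟩⟩⟩
  · ext i j
    rw [T.1.zeros (hempty i j), T'.1.zeros (hempty i j)]
  · exact fun _ h => absurd h (hempty _ _)
  · exact fun _ h => absurd h (hempty _ _)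
  · exact fun _ => rfl
  · exact fun k => colCount_eq_zero_iff.2 fun i j h => absurd h (hempty i j)

theorem rppCount_eq_zero (h : μ < lam) : rppCount lam μ 0 = 0 := by
  obtain ⟨⟨i, j⟩, hlam, hμ⟩ := SetLike.exists_of_lt h
  refine Nat.card_eq_zero.2 (.inl ⟨fun T => ?_⟩)
  simpa using entry_mem_support T.2 (mem_skewCells.2 ⟨hlam, hμ⟩)

end RppCount

/-! ### The generating functions of reverse plane partitions -/

section ProdOp

variable {R K σ τ : Type*} [CommRing R] [CommRing K]

theorem incidenceMap_colOp (φ : R →+* K) (s x : R) :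
    incidenceMap φ (colOp s x) = colOp (φ s) (φ x) := by
  ext μ lam h
  rw [incidenceMap_apply, colOp_apply _ _ h, colOp_apply _ _ h, skewWeight, skewWeight, map_mul,
    map_pow, map_pow]

theorem pairwise_commute_colOp (s : K) (S : Finset σ) :
    (S : Set σ).Pairwise
      (Function.onFun Commute fun k => colOp (.C s) (.X k : MvPolynomial σ K)) :=
  fun _ _ _ _ _ => colOp_commute _ _ _

/-- The product of the operators `colOp s (X k)` for `k ∈ S`. Its matrix entries are the generating
functions of reverse plane partitions with entries in `S`. -/
noncomputable def prodOp (s : K) (S : Finset σ) :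
    IncidenceAlgebra (MvPolynomial σ K) YoungDiagram :=
  S.noncommProd _ (pairwise_commute_colOp s S)

theorem prodOp_empty (s : K) : prodOp s (∅ : Finset σ) = 1 := noncommProd_empty _ _

theorem prodOp_insert [DecidableEq σ] (s : K) {S : Finset σ} {k : σ} (hk : k ∉ S) :
    prodOp s (insert k S) = prodOp s S * colOp (.C s) (.X k) :=
  noncommProd_insert_of_notMem' _ _ _ _ hk

theorem incidenceMap_rename_prodOp (e : σ ↪ τ) (s : K) (S : Finset σ) :
    incidenceMap (MvPolynomial.rename e).toRingHom (prodOp s S) = prodOp s (S.map e) := by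
  refine (Finset.map_noncommProd S _ _ _).trans ?_
  simp [prodOp, noncommProd, Multiset.map_map, incidenceMap_colOp]

theorem sub_single_eq_erase (d : σ →₀ ℕ) (k : σ) : d - Finsupp.single k (d k) = d.erase k :=
  tsub_eq_of_eq_add (Finsupp.erase_add_single k d).symm

theorem single_le_and_support_sub_subset_iff [DecidableEq σ] {S : Finset σ} {k : σ} (hk : k ∉ S)
    (c : ℕ) (d : σ →₀ ℕ) :
    (Finsupp.single k c ≤ d ∧ (d - Finsupp.single k c).support ⊆ S) ↔
      d.support ⊆ insert k S ∧ c = d k := by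
  rw [Finsupp.single_le_iff]
  constructor
  · rintro ⟨hle, hsub⟩
    refine ⟨fun i hi => ?_, ?_⟩
    · rcases eq_or_ne i k with rfl | hik
      · exact mem_insert_self _ _
      · refine mem_insert_of_mem (hsub ?_)
        simpa [Finsupp.single_eq_of_ne hik] using hi
    · have : (d - Finsupp.single k c) k = 0 := Finsupp.notMem_support_iff.1 fun h => hk (hsub h)
      rw [Finsupp.tsub_apply, Finsupp.single_eq_same] at this
      omega
  · rintro ⟨hsub, rfl⟩
    refine ⟨le_rfl, ?_⟩
    rwa [sub_single_eq_erase, Finsupp.support_erase, ← subset_insert_iff]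

theorem colOp_C_X_apply (s : K) (k : σ) {μ lam : YoungDiagram} (h : μ ≤ lam) :
    colOp (.C s) (.X k : MvPolynomial σ K) μ lam =
      .monomial (.single k (numCols lam μ)) (s ^ (#(skewCells lam μ) - numCols lam μ)) := by
  rw [colOp_apply _ _ h, skewWeight, ← map_pow, MvPolynomial.X_pow_eq_monomial, mul_comm,
    MvPolynomial.C_mul_monomial, mul_one]

/-- The generating function of reverse plane partitions of shape `lam / μ` in which a box that
repeats the entry above it contributes a factor `s` (instead of a variable). It is the dual stable
Grothendieck polynomial for `s = 1` and, when `μ` is empty, the Schur function for `s = 0`. -/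
noncomputable def rppSeries (s : K) (lam μ : YoungDiagram) : MvPowerSeries ℕ K :=
  fun d => s ^ (#(skewCells lam μ) - d.degree) * rppCount lam μ d

theorem coeff_rppSeries (s : K) (lam μ : YoungDiagram) (d : ℕ →₀ ℕ) :
    MvPowerSeries.coeff d (rppSeries s lam μ) =
      s ^ (#(skewCells lam μ) - d.degree) * rppCount lam μ d := rfl

theorem coeff_zero_rppSeries (s : K) {μ lam : YoungDiagram} (h : μ ≤ lam) :
    MvPowerSeries.coeff 0 (rppSeries s lam μ) = if μ = lam then 1 else 0 := by
  rw [coeff_rppSeries]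
  split_ifs with heq
  · rw [heq, rppCount_self, skewCells, sdiff_self, bot_eq_empty, card_empty, Nat.zero_sub, pow_zero,
      Nat.cast_one, one_mul]
  · rw [rppCount_eq_zero (h.lt_of_ne heq), Nat.cast_zero, mul_zero]

theorem card_skewCells_add {μ ν lam : YoungDiagram} (hμ : μ ≤ ν) (hν : ν ≤ lam) :
    #(skewCells ν μ) + #(skewCells lam ν) = #(skewCells lam μ) := by
  have h₁ := card_sdiff_add_card_eq_card (YoungDiagram.cells_subset_iff.2 hμ)
  have h₂ := card_sdiff_add_card_eq_card (YoungDiagram.cells_subset_iff.2 hν)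
  have h₃ := card_sdiff_add_card_eq_card (YoungDiagram.cells_subset_iff.2 (hμ.trans hν))
  simp only [skewCells]
  omega

theorem coeff_rppSeries_mul {μ ν lam : YoungDiagram} (hμ : μ ≤ ν) (hν : ν ≤ lam) (s : K)
    {d : ℕ →₀ ℕ} {N : ℕ} (hN : numCols lam ν = d N) :
    MvPowerSeries.coeff (d.erase N) (rppSeries s ν μ) * s ^ (#(skewCells lam ν) - numCols lam ν) =
      s ^ (#(skewCells lam μ) - d.degree) * rppCount ν μ (d.erase N) := by
  rw [coeff_rppSeries, mul_right_comm, ← pow_add]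
  rcases eq_or_ne (rppCount ν μ (d.erase N)) 0 with h | h
  · rw [h, Nat.cast_zero, mul_zero, mul_zero]
  have hdeg : (d.erase N).degree ≤ #(skewCells ν μ) := degree_le_of_rppCount_ne_zero h
  have hcols : numCols lam ν ≤ #(skewCells lam ν) := card_image_le
  have hd : (d.erase N).degree + d N = d.degree := by
    rw [← Finsupp.degree_single N (d N), ← map_add, Finsupp.erase_add_single]
  rw [← card_skewCells_add hμ hν, ← hd, ← hN]
  congr 2
  omega

theorem coeff_prodOp (s : K) {S : Finset ℕ} {μ lam : YoungDiagram} (h : μ ≤ lam) (d : ℕ →₀ ℕ) :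
    (prodOp s S μ lam).coeff d =
      if d.support ⊆ S then MvPowerSeries.coeff d (rppSeries s lam μ) else 0 := by
  induction S using Finset.induction_on_max generalizing lam d with
  | empty =>
    rw [prodOp_empty, IncidenceAlgebra.one_apply, if_congr subset_empty rfl rfl,
      if_congr Finsupp.support_eq_empty rfl rfl]
    split_ifs with hlam hd hd
    · rw [hd, coeff_zero_rppSeries s h, if_pos hlam, MvPolynomial.coeff_zero_one]
    · rw [MvPolynomial.coeff_one, if_neg (Ne.symm hd)]
    · rw [hd, coeff_zero_rppSeries s h, if_neg hlam, MvPolynomial.coeff_zero]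
    · exact MvPolynomial.coeff_zero d
  | insert N S hS ih =>
    have hN : N ∉ S := fun hmem => lt_irrefl N (hS N hmem)
    rw [prodOp_insert s hN, IncidenceAlgebra.mul_apply, MvPolynomial.coeff_sum, coeff_rppSeries]
    have hterm : ∀ ν ∈ Icc μ lam,
        (prodOp s S μ ν * colOp (.C s) (.X N) ν lam).coeff d =
          if d.support ⊆ insert N S ∧ numCols lam ν = d N then
            s ^ (#(skewCells lam μ) - d.degree) * rppCount ν μ (d.erase N) else 0 := by
      intro ν hν
      obtain ⟨hμν, hνlam⟩ := mem_Icc.1 hν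
      rw [colOp_C_X_apply s N hνlam, MvPolynomial.coeff_mul_monomial', ih hμν, ite_mul, zero_mul,
        ← ite_and, if_congr (single_le_and_support_sub_subset_iff hN _ d) rfl rfl]
      split_ifs with hd
      · rw [← coeff_rppSeries_mul hμν hνlam s hd.2, hd.2, sub_single_eq_erase]
      · rfl
    rw [sum_congr rfl hterm]
    by_cases hd : d.support ⊆ insert N S
    · have hle : ∀ k ∈ d.support, k ≤ N := fun k hk => by
        rcases mem_insert.1 (hd hk) with rfl | hkS
        exacts [le_rfl, (hS k hkS).le]
      simp only [hd, true_and, if_true, rppCount_eq_sum h hle, Nat.cast_sum, mul_sum, Nat.cast_ite,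
        Nat.cast_zero, mul_ite, mul_zero]
    · simp only [hd, false_and, if_false, sum_const_zero]

theorem coeff_embDomain_rppSeries (e : σ ↪ ℕ) (s : K) {S : Finset σ} {μ lam : YoungDiagram}
    (h : μ ≤ lam) {d : σ →₀ ℕ} (hd : d.support ⊆ S) :
    MvPowerSeries.coeff (d.embDomain e) (rppSeries s lam μ) = (prodOp s S μ lam).coeff d := by
  have hS : (d.embDomain e).support ⊆ S.map e := by
    rw [Finsupp.support_embDomain]
    exact map_subset_map.2 hd
  rw [← MvPolynomial.coeff_rename_embDomain e]
  change _ = (incidenceMap (MvPolynomial.rename e).toRingHom (prodOp s S) μ lam).coeff _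
  rw [incidenceMap_rename_prodOp, coeff_prodOp s h, if_pos hS]

end ProdOp

section Symmetric

variable {K : Type*} [CommRing K]

theorem mem_symSeries_iff {F : MvPowerSeries ℕ K} :
    F ∈ SymSeries K ↔ ∀ (σ : Equiv.Perm ℕ) (d : ℕ →₀ ℕ),
      MvPowerSeries.coeff (d.embDomain σ.toEmbedding) F = MvPowerSeries.coeff d F := by
  refine ⟨fun hF σ d => ?_, fun hF σ => ?_⟩
  · conv_lhs => rw [← hF σ]
    exact MvPowerSeries.coeff_embDomain_rename σ.toEmbedding F d
  · ext d
    obtain ⟨d, rfl⟩ := Finsupp.mapDomain_surjective σ.surjective d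
    rw [← Equiv.coe_toEmbedding, ← Finsupp.embDomain_eq_mapDomain, hF σ d]
    exact MvPowerSeries.coeff_embDomain_rename σ.toEmbedding F d

theorem rppSeries_mem_symSeries (s : K) {μ lam : YoungDiagram} (h : μ ≤ lam) :
    rppSeries s lam μ ∈ SymSeries K := by
  refine mem_symSeries_iff.2 fun σ d => ?_
  rw [coeff_embDomain_rppSeries _ s h subset_rfl,
    ← coeff_embDomain_rppSeries (Function.Embedding.refl ℕ) s h subset_rfl,
    Finsupp.embDomain_refl, id_eq]

theorem rppSeries_mem_symFun (s : K) {μ lam : YoungDiagram} (h : μ ≤ lam) :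
    rppSeries s lam μ ∈ SymFun K := by
  refine ⟨rppSeries_mem_symSeries s h, #(skewCells lam μ), fun d hd => ?_⟩
  rw [coeff_rppSeries, not_imp_comm.1 degree_le_of_rppCount_ne_zero hd.not_ge, Nat.cast_zero,
    mul_zero]

theorem rppSeries_one (lam μ : YoungDiagram) : rppSeries (1 : K) lam μ = dualGroth K lam μ := by
  funext d
  rw [rppSeries, one_pow, one_mul]
  rfl

end Symmetric

section Tableaux

variable {K : Type*} [CommRing K] {lam : YoungDiagram}

theorem skewCells_bot (lam : YoungDiagram) : skewCells lam ⊥ = lam.cells := sdiff_empty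

namespace ReversePlanePartition

/-- A semistandard tableau, regarded as a reverse plane partition. -/
def ofTableau (T : SemistandardYoungTableau lam) : ReversePlanePartition lam ⊥ where
  entry := T
  row_weak hj _ h := T.row_weak hj (mem_skewCells.1 h).1
  col_weak hi _ h := T.col_weak hi.le (mem_skewCells.1 h).1
  zeros h := T.zeros fun hc => h (mem_skewCells.2 ⟨hc, YoungDiagram.notMem_bot _⟩)

theorem colCount_ofTableau (T : SemistandardYoungTableau lam) (k : ℕ) :
    (ofTableau T).colCount k = #{c ∈ lam.cells | T c.1 c.2 = k} := by
  rw [colCount, skewCells_bot]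
  refine card_image_of_injOn ?_
  rintro ⟨i, j⟩ hc ⟨i', j'⟩ hc' (hj : j = j')
  obtain ⟨hc, hk⟩ := mem_filter.1 hc
  obtain ⟨hc', hk'⟩ := mem_filter.1 hc'
  subst hj
  rcases lt_trichotomy i i' with hi | rfl | hi
  · exact absurd (hk.trans hk'.symm) (T.col_strict hi hc').ne
  · rfl
  · exact absurd (hk'.trans hk.symm) (T.col_strict hi hc).ne

theorem card_filter_eq_colCount {T : ReversePlanePartition lam ⊥} {d : ℕ →₀ ℕ}
    (hT : ∀ k, T.colCount k = d k) (hd : d.degree = #(skewCells lam ⊥)) {k : ℕ}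
    (hk : k ∈ d.support) : T.colCount k = #{c ∈ skewCells lam ⊥ | T.entry c.1 c.2 = k} := by
  have hle : ∀ k ∈ d.support, T.colCount k ≤ #{c ∈ skewCells lam ⊥ | T.entry c.1 c.2 = k} :=
    fun k _ => card_image_le
  refine (sum_eq_sum_iff_of_le hle).1 ?_ k hk
  rw [sum_card_filter_eq hT, ← hd, Finsupp.degree_apply, sum_congr rfl fun k _ => hT k]

theorem entry_lt_of_degree_eq {T : ReversePlanePartition lam ⊥} {d : ℕ →₀ ℕ}
    (hT : ∀ k, T.colCount k = d k) (hd : d.degree = #(skewCells lam ⊥)) {i i' j : ℕ} (hi : i < i')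
    (h : (i, j) ∈ skewCells lam ⊥) (h' : (i', j) ∈ skewCells lam ⊥) :
    T.entry i j < T.entry i' j := by
  refine (T.col_weak hi h h').lt_of_ne fun heq => hi.ne ?_
  have hinj := card_image_iff.1 (card_filter_eq_colCount hT hd (entry_mem_support hT h))
  exact congrArg Prod.fst (hinj (mem_filter.2 ⟨h, rfl⟩) (mem_filter.2 ⟨h', heq.symm⟩) rfl)

end ReversePlanePartition

/-- The Kostka number: the number of semistandard tableaux of shape `lam` in which each `k` occurs
exactly `d k` times. -/
noncomputable def kostka (lam : YoungDiagram) (d : ℕ →₀ ℕ) : ℕ :=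
  Nat.card {T : SemistandardYoungTableau lam // ∀ k, #{c ∈ lam.cells | T c.1 c.2 = k} = d k}

theorem coeff_schur (lam : YoungDiagram) (d : ℕ →₀ ℕ) :
    MvPowerSeries.coeff d (schur K lam) = kostka lam d := rfl

theorem degree_eq_card {T : SemistandardYoungTableau lam} {d : ℕ →₀ ℕ}
    (hT : ∀ k, #{c ∈ lam.cells | T c.1 c.2 = k} = d k) : d.degree = lam.card := by
  have h := ReversePlanePartition.sum_card_filter_eq (T := .ofTableau T) (d := d) fun k => by
    rw [ReversePlanePartition.colCount_ofTableau, hT k]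
  rw [skewCells_bot] at h
  rw [Finsupp.degree_apply, ← sum_congr rfl fun k _ => hT k]
  exact h

theorem kostka_eq_zero_of_degree_ne {d : ℕ →₀ ℕ} (hd : d.degree ≠ lam.card) : kostka lam d = 0 :=
  Nat.card_eq_zero.2 (.inl ⟨fun T => hd (degree_eq_card T.2)⟩)

open ReversePlanePartition in
/-- A reverse plane partition of straight shape with as many monomial factors as boxes has no
repeated entry in a column, so it is a semistandard tableau. -/
def tableauEquiv {d : ℕ →₀ ℕ} (hd : d.degree = lam.card) :
    {T : SemistandardYoungTableau lam // ∀ k, #{c ∈ lam.cells | T c.1 c.2 = k} = d k} ≃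
      {T : ReversePlanePartition lam ⊥ // ∀ k, T.colCount k = d k} where
  toFun T := ⟨.ofTableau T, fun k => (colCount_ofTableau T.1 k).trans (T.2 k)⟩
  invFun T := by
    have hlam {i j : ℕ} (h : (i, j) ∈ lam) : (i, j) ∈ skewCells lam ⊥ := by rwa [skewCells_bot]
    have hdeg : d.degree = #(skewCells lam ⊥) := by rwa [skewCells_bot]
    let T' : SemistandardYoungTableau lam :=
      { entry := T.1.entry
        row_weak' := fun hj h => T.1.row_weak hj (hlam (lam.up_left_mem le_rfl hj.le h)) (hlam h)
        col_strict' := fun hi h =>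
          entry_lt_of_degree_eq T.2 hdeg hi (hlam (lam.up_left_mem hi.le le_rfl h)) (hlam h)
        zeros' := fun h => T.1.zeros (by rwa [skewCells_bot]) }
    exact ⟨T', fun k => (colCount_ofTableau T' k).symm.trans (T.2 k)⟩
  left_inv _ := rfl
  right_inv _ := rfl

theorem rppSeries_zero (lam : YoungDiagram) : rppSeries (0 : K) lam ⊥ = schur K lam := by
  ext d
  rw [coeff_rppSeries, coeff_schur, skewCells_bot]
  rcases eq_or_ne d.degree lam.card with hd | hd
  · rw [hd, YoungDiagram.card, Nat.sub_self, pow_zero, one_mul, kostka,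
      Nat.card_congr (tableauEquiv hd), rppCount]
  rw [kostka_eq_zero_of_degree_ne hd, Nat.cast_zero]
  by_cases h : rppCount lam ⊥ d = 0
  · rw [h, Nat.cast_zero, mul_zero]
  · have hle := degree_le_of_rppCount_ne_zero h
    rw [skewCells_bot] at hle
    rw [zero_pow (Nat.sub_pos_of_lt (hle.lt_of_ne hd)).ne', zero_mul]

theorem schur_mem_symFun (lam : YoungDiagram) : schur K lam ∈ SymFun K :=
  rppSeries_zero (K := K) lam ▸ rppSeries_mem_symFun 0 bot_le

end Tableaux

/-! ### Unitriangularity of the Kostka numbers -/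

theorem existsUnique_of_unitriangular {ι K : Type*} [Ring K] {rank : ι → ℕ} {s : ι → Finset ι}
    (hs : ∀ i, ∀ j ∈ s i, rank j < rank i) (M : ι → ι → K) (b : ι → K) :
    ∃! A : ι → K, ∀ i, A i + ∑ j ∈ s i, A j * M i j = b i := by
  have hwf : WellFounded (InvImage (· < ·) rank) := InvImage.wf rank wellFounded_lt
  let step (i : ι) (A : ∀ j, rank j < rank i → K) : K :=
    b i - ∑ j ∈ (s i).attach, A j (hs i j j.2) * M i j
  refine ⟨hwf.fix step, fun i => ?_, fun A hA => funext fun i => ?_⟩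
  · rw [hwf.fix_eq, sub_add_eq_add_sub, sub_eq_iff_eq_add, add_right_inj]
    exact (sum_attach (s i) fun j => hwf.fix step j * M i j).symm
  · induction i using hwf.induction with
    | _ i ih =>
      rw [hwf.fix_eq, eq_sub_of_add_eq (hA i), sub_right_inj, ← sum_attach]
      exact sum_congr rfl fun j _ => congrArg (· * M i j) (ih j (hs i j j.2))

section Kostka

variable {lam μ : YoungDiagram} {d : ℕ →₀ ℕ}

/-- The row lengths of a Young diagram as an exponent vector. -/
noncomputable def rowExp (μ : YoungDiagram) : ℕ →₀ ℕ :=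
  .onFinset (range (μ.colLen 0)) μ.rowLen fun i hi => by
    rw [mem_range, ← YoungDiagram.mem_iff_lt_colLen, YoungDiagram.mem_iff_lt_rowLen]
    exact Nat.pos_of_ne_zero hi

@[simp]
theorem rowExp_apply (μ : YoungDiagram) (i : ℕ) : rowExp μ i = μ.rowLen i := rfl

theorem card_filter_highestWeight (lam : YoungDiagram) (k : ℕ) :
    #{c ∈ lam.cells | SemistandardYoungTableau.highestWeight lam c.1 c.2 = k} = rowExp lam k := by
  rw [rowExp_apply, YoungDiagram.rowLen_eq_card]
  refine congrArg card (filter_congr fun c hc => ?_)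
  rw [SemistandardYoungTableau.highestWeight_apply, if_pos ((YoungDiagram.mem_cells _).1 hc)]

theorem degree_rowExp (μ : YoungDiagram) : (rowExp μ).degree = μ.card :=
  degree_eq_card (card_filter_highestWeight μ)

theorem row_le_entry (T : SemistandardYoungTableau lam) {i j : ℕ} (h : (i, j) ∈ lam) :
    i ≤ T i j := by
  induction i with
  | zero => exact Nat.zero_le _
  | succ i ih =>
    exact (ih (lam.up_left_mem i.le_succ le_rfl h)).trans_lt (T.col_strict i.lt_succ_self h)

theorem sum_entry_eq {T : SemistandardYoungTableau lam}
    (hT : ∀ k, #{c ∈ lam.cells | T c.1 c.2 = k} = d k) :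
    ∑ c ∈ lam.cells, T c.1 c.2 = ∑ k ∈ d.support, d k * k := by
  have hmem : ∀ c ∈ lam.cells, T c.1 c.2 ∈ d.support := fun c hc => by
    rw [Finsupp.mem_support_iff, ← hT, card_ne_zero]
    exact ⟨c, mem_filter.2 ⟨hc, rfl⟩⟩
  rw [← sum_fiberwise_of_maps_to hmem]
  refine sum_congr rfl fun k _ => ?_
  rw [sum_congr rfl fun c hc => (mem_filter.1 hc).2, sum_const, hT, smul_eq_mul]

/-- The sum of the row indices of the boxes of `lam`, often written `n(lam)`. It is the smallest
sum of entries of a semistandard tableau of shape `lam`. -/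
def rowSum (lam : YoungDiagram) : ℕ := ∑ c ∈ lam.cells, c.1

theorem sum_rowExp_mul (μ : YoungDiagram) :
    ∑ k ∈ (rowExp μ).support, rowExp μ k * k = rowSum μ := by
  rw [← sum_entry_eq (card_filter_highestWeight μ)]
  refine sum_congr rfl fun c hc => ?_
  rw [SemistandardYoungTableau.highestWeight_apply, if_pos ((YoungDiagram.mem_cells _).1 hc)]

theorem rowSum_le {T : SemistandardYoungTableau lam}
    (hT : ∀ k, #{c ∈ lam.cells | T c.1 c.2 = k} = rowExp μ k) : rowSum lam ≤ rowSum μ := by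
  rw [← sum_rowExp_mul μ, ← sum_entry_eq hT]
  exact sum_le_sum fun c hc => row_le_entry T ((YoungDiagram.mem_cells _).1 hc)

theorem eq_highestWeight {T : SemistandardYoungTableau lam}
    (hT : ∀ k, #{c ∈ lam.cells | T c.1 c.2 = k} = rowExp μ k) (h : rowSum lam = rowSum μ) :
    T = .highestWeight lam := by
  have hle : ∀ c ∈ lam.cells, c.1 ≤ T c.1 c.2 := fun c hc =>
    row_le_entry T ((YoungDiagram.mem_cells _).1 hc)
  rw [← sum_rowExp_mul μ, ← sum_entry_eq hT] at h
  ext i j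
  rw [SemistandardYoungTableau.highestWeight_apply]
  split_ifs with hc
  · exact ((sum_eq_sum_iff_of_le hle).1 h (i, j) ((YoungDiagram.mem_cells _).2 hc)).symm
  · exact T.zeros hc

theorem kostka_self (lam : YoungDiagram) : kostka lam (rowExp lam) = 1 := by
  refine Nat.card_eq_one_iff_unique.2 ⟨⟨fun T T' => Subtype.ext ?_⟩,
    ⟨⟨.highestWeight lam, card_filter_highestWeight lam⟩⟩⟩
  rw [eq_highestWeight T.2 rfl, eq_highestWeight T'.2 rfl]

theorem rowLen_injective : Function.Injective YoungDiagram.rowLen := fun μ ν h =>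
  YoungDiagram.ext (Finset.ext fun ⟨i, j⟩ => by
    rw [YoungDiagram.mem_cells, YoungDiagram.mem_cells, YoungDiagram.mem_iff_lt_rowLen,
      YoungDiagram.mem_iff_lt_rowLen, h])

theorem rowSum_lt_of_kostka_ne_zero (h : kostka lam (rowExp μ) ≠ 0) (hne : lam ≠ μ) :
    rowSum lam < rowSum μ := by
  obtain ⟨⟨T, hT⟩⟩ := (Nat.card_ne_zero.1 h).1
  refine (rowSum_le hT).lt_of_ne fun heq => hne (rowLen_injective (funext fun k => ?_))
  rw [← rowExp_apply lam, ← rowExp_apply μ, ← hT k, eq_highestWeight hT heq,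
    card_filter_highestWeight]

theorem le_numCols_of_kostka_ne_zero (h : kostka lam d ≠ 0) (k : ℕ) : d k ≤ numCols lam ⊥ := by
  obtain ⟨⟨T, hT⟩⟩ := (Nat.card_ne_zero.1 h).1
  rw [← hT k, ← ReversePlanePartition.colCount_ofTableau T k]
  exact card_le_card (image_subset_image (filter_subset _ _))

end Kostka

/-! ### The expansion of a symmetric series into Schur functions -/

theorem finite_setOf_card_le (n : ℕ) : {lam : YoungDiagram | lam.card ≤ n}.Finite := by
  refine Set.Finite.of_finite_image (f := YoungDiagram.cells)
    ((range n ×ˢ range n).powerset.finite_toSet.subset ?_) fun a _ b _ h => YoungDiagram.ext h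
  rintro _ ⟨lam, hlam, rfl⟩
  refine mem_coe.2 (mem_powerset.2 fun ⟨i, j⟩ hc => ?_)
  have hi : i < lam.colLen j := YoungDiagram.mem_iff_lt_colLen.1 hc
  have hj : j < lam.rowLen i := YoungDiagram.mem_iff_lt_rowLen.1 hc
  rw [YoungDiagram.colLen_eq_card] at hi
  rw [YoungDiagram.rowLen_eq_card] at hj
  exact mem_product.2 ⟨mem_range.2 (hi.trans_le ((card_filter_le _ _).trans hlam)),
    mem_range.2 (hj.trans_le ((card_filter_le _ _).trans hlam))⟩

/-- The Young diagrams with `n` boxes. -/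
noncomputable def diagrams (n : ℕ) : Finset YoungDiagram :=
  {lam ∈ (finite_setOf_card_le n).toFinset | lam.card = n}

theorem mem_diagrams {n : ℕ} {lam : YoungDiagram} : lam ∈ diagrams n ↔ lam.card = n := by
  simpa [diagrams] using le_of_eq

theorem exists_antitone_comp_perm (d : ℕ →₀ ℕ) : ∃ σ : Equiv.Perm ℕ, Antitone (d ∘ σ) := by
  obtain ⟨N, hN⟩ := d.support.exists_nat_subset_range
  have hd0 : ∀ i, N ≤ i → d i = 0 := fun i hi =>
    Finsupp.notMem_support_iff.1 fun h => hi.not_gt (mem_range.1 (hN h))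
  let f (i : Fin N) : ℕᵒᵈ := .toDual (d i)
  let σ : Equiv.Perm ℕ := (Tuple.sort f).viaEmbedding Fin.valEmbedding
  have hσ (i : Fin N) : σ i = Tuple.sort f i :=
    Equiv.Perm.viaEmbedding_apply (Tuple.sort f) Fin.valEmbedding i
  have hσ' (i : ℕ) (hi : N ≤ i) : σ i = i :=
    Equiv.Perm.viaEmbedding_apply_of_notMem (Tuple.sort f) Fin.valEmbedding i <| by
      rintro ⟨k, rfl⟩
      exact hi.not_gt k.2
  refine ⟨σ, fun i j hij => ?_⟩
  rcases lt_or_ge j N with hj | hj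
  · have hsort := Tuple.monotone_sort f (a := ⟨i, hij.trans_lt hj⟩) (b := ⟨j, hj⟩) hij
    simp only [Function.comp_apply, f, OrderDual.toDual_le_toDual, ← hσ] at hsort
    exact hsort
  · simp [hσ' j hj, hd0 j hj]

theorem exists_embDomain_rowExp (d : ℕ →₀ ℕ) :
    ∃ (σ : Equiv.Perm ℕ) (μ : YoungDiagram), (rowExp μ).embDomain σ.toEmbedding = d := by
  obtain ⟨σ, hσ⟩ := exists_antitone_comp_perm d
  obtain ⟨N, hN⟩ := (d.comapDomain σ σ.injective.injOn).support.exists_nat_subset_range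
  have hzero : ∀ i, N ≤ i → (d ∘ σ) i = 0 := fun i hi =>
    (Finsupp.notMem_support_iff (f := d.comapDomain σ σ.injective.injOn)).1 fun h =>
      hi.not_gt (mem_range.1 (hN h))
  refine ⟨σ, (ofColLens (d ∘ σ) hσ N).transpose, Finsupp.ext fun k => ?_⟩
  obtain ⟨m, rfl⟩ := σ.surjective k
  refine (Finsupp.embDomain_apply_self σ.toEmbedding _ m).trans ?_
  rw [rowExp_apply, YoungDiagram.rowLen_transpose, colLen_ofColLens hσ hzero, Function.comp_apply]

section Expansion

variable {K : Type*} [CommRing K] {F : MvPowerSeries ℕ K}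

theorem finsum_mul_coeff_schur (A : YoungDiagram → K) (d : ℕ →₀ ℕ) :
    ∑ᶠ lam, A lam * MvPowerSeries.coeff d (schur K lam) =
      ∑ lam ∈ diagrams d.degree, A lam * MvPowerSeries.coeff d (schur K lam) := by
  refine finsum_eq_sum_of_support_subset _ fun lam h => mem_diagrams.2 ?_
  by_contra hne
  refine h ?_
  dsimp only
  rw [coeff_schur, kostka_eq_zero_of_degree_ne (Ne.symm hne), Nat.cast_zero, mul_zero]

theorem isSchurExpansion_iff (hF : F ∈ SymSeries K) {A : YoungDiagram → K} :
    IsSchurExpansion F A ↔ ∀ μ : YoungDiagram,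
      ∑ lam ∈ diagrams μ.card, A lam * MvPowerSeries.coeff (rowExp μ) (schur K lam) =
        MvPowerSeries.coeff (rowExp μ) F := by
  constructor
  · intro h μ
    rw [h, finsum_mul_coeff_schur, degree_rowExp]
  · intro h d
    obtain ⟨σ, μ, rfl⟩ := exists_embDomain_rowExp d
    rw [mem_symSeries_iff.1 hF, ← h, ← degree_rowExp, ← finsum_mul_coeff_schur]
    exact finsum_congr fun lam => by rw [mem_symSeries_iff.1 (schur_mem_symFun lam).1]

theorem sum_diagrams_mul_coeff_schur (A : YoungDiagram → K) (μ : YoungDiagram) :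
    ∑ lam ∈ diagrams μ.card, A lam * MvPowerSeries.coeff (rowExp μ) (schur K lam) =
      A μ + ∑ lam ∈ {lam ∈ diagrams μ.card | rowSum lam < rowSum μ},
        A lam * kostka lam (rowExp μ) := by
  rw [← add_sum_erase _ _ (mem_diagrams.2 (rfl : μ.card = μ.card)), coeff_schur, kostka_self,
    Nat.cast_one, mul_one, add_right_inj]
  refine (sum_subset (fun lam h => ?_) fun lam hlam h => ?_).symm
  · exact mem_erase.2 ⟨fun heq => (mem_filter.1 h).2.ne (heq ▸ rfl), (mem_filter.1 h).1⟩
  · obtain ⟨hne, hmem⟩ := mem_erase.1 hlam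
    have hk : kostka lam (rowExp μ) = 0 := by
      by_contra hk
      exact h (mem_filter.2 ⟨hmem, rowSum_lt_of_kostka_ne_zero hk hne⟩)
    rw [coeff_schur, hk, Nat.cast_zero, mul_zero]

theorem existsUnique_isSchurExpansion (hF : F ∈ SymSeries K) : ∃! A, IsSchurExpansion F A := by
  simp only [isSchurExpansion_iff hF, sum_diagrams_mul_coeff_schur]
  exact existsUnique_of_unitriangular (fun μ lam h => (mem_filter.1 h).2) _ _

theorem isSchurExpansion_schurCoeff (hF : F ∈ SymSeries K) :
    IsSchurExpansion F (schurCoeff F) := by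
  have hex := (existsUnique_isSchurExpansion hF).exists
  rw [schurCoeff, dif_pos hex]
  exact hex.choose_spec

theorem schurCoeff_eq (hF : F ∈ SymSeries K) {A : YoungDiagram → K} (h : IsSchurExpansion F A) :
    schurCoeff F = A :=
  (existsUnique_isSchurExpansion hF).unique (isSchurExpansion_schurCoeff hF) h

theorem schurCoeff_eq_zero (hF : F ∈ SymSeries K) {N : ℕ}
    (hN : ∀ d : ℕ →₀ ℕ, N < d.degree → MvPowerSeries.coeff d F = 0) {lam : YoungDiagram}
    (h : N < lam.card) : schurCoeff F lam = 0 := by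
  have hA : IsSchurExpansion F fun lam => if N < lam.card then 0 else schurCoeff F lam := by
    refine (isSchurExpansion_iff hF).2 fun μ => ?_
    have hμ : ∀ lam ∈ diagrams μ.card, lam.card = μ.card := fun lam => mem_diagrams.1
    by_cases hd : N < μ.card
    · rw [hN _ (by rwa [degree_rowExp])]
      exact sum_eq_zero fun lam hlam => by rw [if_pos (by rwa [hμ lam hlam]), zero_mul]
    · rw [← (isSchurExpansion_iff hF).1 (isSchurExpansion_schurCoeff hF)]
      exact sum_congr rfl fun lam hlam => by rw [if_neg (by rwa [hμ lam hlam])]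
  exact (congrFun (schurCoeff_eq hF hA) lam).trans (if_pos h)

theorem finite_support_schurCoeff (hF : F ∈ SymFun K) : (schurCoeff F).support.Finite := by
  obtain ⟨hsym, N, hN⟩ := hF
  exact (finite_setOf_card_le N).subset fun lam h =>
    not_lt.1 fun hlt => h (schurCoeff_eq_zero hsym hN hlt)

theorem eq_sum_schurCoeff_smul (hF : F ∈ SymSeries K) {S : Finset YoungDiagram}
    (hS : (schurCoeff F).support ⊆ S) : F = ∑ lam ∈ S, schurCoeff F lam • schur K lam := by
  ext d
  rw [isSchurExpansion_schurCoeff hF d, map_sum]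
  exact finsum_eq_sum_of_support_subset _ ((Function.support_mul_subset_left _ _).trans hS)

end Expansion

/-! ### One-column diagrams and the series `E t` -/

theorem mem_oneColumn {n i j : ℕ} : (i, j) ∈ oneColumn n ↔ i < n ∧ j = 0 := by
  rw [← YoungDiagram.mem_cells, oneColumn, mem_product, mem_range, mem_singleton]

theorem card_oneColumn (n : ℕ) : (oneColumn n).card = n := by
  rw [YoungDiagram.card, oneColumn, card_product, card_range, card_singleton, mul_one]

theorem isVerticalStrip_bot_iff_rowLen {lam : YoungDiagram} :
    IsVerticalStrip lam ⊥ ↔ ∀ i, lam.rowLen i ≤ 1 := by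
  simp only [IsVerticalStrip, skewCells_bot, YoungDiagram.mem_cells]
  constructor
  · intro h i
    by_contra! hlt
    simpa using h (i, 0) (YoungDiagram.mem_iff_lt_rowLen.2 (by omega)) (i, 1)
      (YoungDiagram.mem_iff_lt_rowLen.2 hlt) rfl
  · rintro h ⟨i, j⟩ hj ⟨i', j'⟩ hj' (rfl : i = i')
    have hj := (YoungDiagram.mem_iff_lt_rowLen.1 hj).trans_le (h i)
    have hj' := (YoungDiagram.mem_iff_lt_rowLen.1 hj').trans_le (h i)
    rw [Nat.lt_one_iff.1 hj, Nat.lt_one_iff.1 hj']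

theorem isVerticalStrip_bot_iff {lam : YoungDiagram} :
    IsVerticalStrip lam ⊥ ↔ ∃ n, lam = oneColumn n := by
  constructor
  · refine fun h => ⟨lam.colLen 0, YoungDiagram.ext (Finset.ext fun ⟨i, j⟩ => ?_)⟩
    rw [YoungDiagram.mem_cells, YoungDiagram.mem_cells, mem_oneColumn,
      ← YoungDiagram.mem_iff_lt_colLen]
    constructor
    · intro hc
      have hj := (YoungDiagram.mem_iff_lt_rowLen.1 hc).trans_le
        (isVerticalStrip_bot_iff_rowLen.1 h i)
      obtain rfl := Nat.lt_one_iff.1 hj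
      exact ⟨hc, rfl⟩
    · rintro ⟨hc, rfl⟩
      exact hc
  · rintro ⟨n, rfl⟩ ⟨i, j⟩ hj ⟨i', j'⟩ hj' (rfl : i = i')
    simp only [skewCells_bot, YoungDiagram.mem_cells, mem_oneColumn] at hj hj'
    rw [hj.2, hj'.2]

theorem numCols_oneColumn (n : ℕ) : numCols (oneColumn n) ⊥ = min n 1 := by
  rw [numCols, skewCells_bot, oneColumn]
  cases n with
  | zero => simp
  | succ n =>
    rw [product_image_snd (nonempty_range_iff.2 n.succ_ne_zero), card_singleton,
      min_eq_right n.succ_pos]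

section ElemGen

variable {K : Type*} [CommRing K]

open Classical in
theorem coeff_elemGen (t : K) (d : ℕ →₀ ℕ) :
    MvPowerSeries.coeff d (elemGen t) = if ∀ k, d k ≤ 1 then t ^ d.degree else 0 := by
  refine (finsum_eq_single _ d.degree fun i hi => ?_).trans ?_
  · exact (congrArg (t ^ i * ·) (if_neg fun h => hi h.2.symm)).trans (mul_zero _)
  · refine (congrArg (t ^ d.degree * ·) (if_congr (and_iff_left rfl) rfl rfl)).trans ?_
    rw [mul_ite, mul_one, mul_zero]

theorem kostka_oneColumn_eq_zero {μ : YoungDiagram} (hμ : ¬ IsVerticalStrip μ ⊥) (n : ℕ) :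
    kostka (oneColumn n) (rowExp μ) = 0 := by
  by_contra h
  refine hμ (isVerticalStrip_bot_iff_rowLen.2 fun i => (le_numCols_of_kostka_ne_zero h i).trans ?_)
  rw [numCols_oneColumn]
  exact min_le_right n 1

theorem schurCoeff_elemGen (t : K) (lam : YoungDiagram) :
    schurCoeff (elemGen t) lam = if IsVerticalStrip lam ⊥ then t ^ lam.card else 0 := by
  classical
  refine congrFun (schurCoeff_eq (elemGen_mem t)
    (A := fun lam => if IsVerticalStrip lam ⊥ then t ^ lam.card else 0)
    ((isSchurExpansion_iff (elemGen_mem t)).2 fun μ => ?_)) lam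
  simp only [coeff_elemGen, degree_rowExp, rowExp_apply, coeff_schur]
  rw [if_congr isVerticalStrip_bot_iff_rowLen.symm rfl rfl,
    sum_eq_single_of_mem (oneColumn μ.card) (mem_diagrams.2 (card_oneColumn _)),
    if_pos (isVerticalStrip_bot_iff.2 ⟨_, rfl⟩), card_oneColumn]
  · split_ifs with h
    · obtain ⟨n, rfl⟩ := isVerticalStrip_bot_iff.1 h
      rw [card_oneColumn, kostka_self, Nat.cast_one, mul_one]
    · rw [kostka_oneColumn_eq_zero h μ.card, Nat.cast_zero, mul_zero]
  · intro lam hlam hne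
    rw [if_neg, zero_mul]
    rintro h
    obtain ⟨n, rfl⟩ := isVerticalStrip_bot_iff.1 h
    exact hne (by rw [← mem_diagrams.1 hlam, card_oneColumn])

end ElemGen

/-! ### Restriction to finitely many variables -/

section Restriction

variable {K σ : Type*} [CommRing K]

theorem coeff_coeToMvPowerSeries_algHom (p : MvPolynomial σ K) (d : σ →₀ ℕ) :
    MvPowerSeries.coeff d (MvPolynomial.coeToMvPowerSeries.algHom K p) = p.coeff d := by
  rw [MvPolynomial.coeToMvPowerSeries.algHom_apply, Algebra.algebraMap_self, MvPowerSeries.map_id,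
    RingHom.id_apply, MvPolynomial.coeff_coe]

theorem coeToMvPowerSeries_algHom_injective :
    Function.Injective (MvPolynomial.coeToMvPowerSeries.algHom (σ := σ) (R := K) K) :=
  fun p q h => MvPolynomial.ext p q fun d => by
    rw [← coeff_coeToMvPowerSeries_algHom, h, coeff_coeToMvPowerSeries_algHom]

theorem mem_range_coeToMvPowerSeries_algHom [Finite σ] {F : MvPowerSeries σ K} {N : ℕ}
    (hF : ∀ d : σ →₀ ℕ, N < d.degree → MvPowerSeries.coeff d F = 0) :
    F ∈ (MvPolynomial.coeToMvPowerSeries.algHom (σ := σ) (R := K) K).range := by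
  refine ⟨MvPowerSeries.truncTotal (N + 1) F, MvPowerSeries.ext fun d => ?_⟩
  refine (coeff_coeToMvPowerSeries_algHom _ d).trans ?_
  rcases lt_or_ge N d.degree with h | h
  · rw [hF d h, MvPowerSeries.coeff_truncTotal_eq_zero _ h]
  · rw [MvPowerSeries.coeff_truncTotal _ (Nat.lt_succ_of_le h)]

/-- The polynomial in the variables `σ` obtained from a symmetric function by setting to zero all
variables outside the range of `e : σ ↪ ℕ`. -/
noncomputable def restrictVars (K : Type*) [CommRing K] [Finite σ] (e : σ ↪ ℕ) :
    SymFun K →ₐ[K] MvPolynomial σ K :=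
  (AlgEquiv.ofInjective _ coeToMvPowerSeries_algHom_injective).symm.toAlgHom.comp
    (((MvPowerSeries.killCompl e).comp (SymFun K).val).codRestrict _ fun f => by
      obtain ⟨_, N, hN⟩ := f.2
      refine mem_range_coeToMvPowerSeries_algHom (N := N) fun d hd => ?_
      refine hN _ ?_
      rwa [Finsupp.embDomain_eq_mapDomain, Finsupp.degree_mapDomain])

theorem coeff_restrictVars [Finite σ] (e : σ ↪ ℕ) (f : SymFun K) (d : σ →₀ ℕ) :
    (restrictVars K e f).coeff d = MvPowerSeries.coeff (d.embDomain e) (f : MvPowerSeries ℕ K) := by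
  rw [← coeff_coeToMvPowerSeries_algHom]
  exact congrArg
    (fun F : (MvPolynomial.coeToMvPowerSeries.algHom (R := K) K).range => MvPowerSeries.coeff d F.1)
    ((AlgEquiv.ofInjective _ coeToMvPowerSeries_algHom_injective).apply_symm_apply _)

theorem restrictVars_rppSeries [Fintype σ] (e : σ ↪ ℕ) (s : K) {μ lam : YoungDiagram}
    (h : μ ≤ lam) :
    restrictVars K e ⟨rppSeries s lam μ, rppSeries_mem_symFun s h⟩ = prodOp s univ μ lam := by
  ext d
  rw [coeff_restrictVars, coeff_embDomain_rppSeries e s h (subset_univ _)]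

end Restriction

/-! ### The pairing with `E t` -/

section Pairing

variable {K : Type*} [CommRing K]

theorem incidenceMap_aeval_prodOp {σ : Type*} (s x : K) (S : Finset σ) :
    incidenceMap (MvPolynomial.aeval (R := K) fun _ : σ => x).toRingHom (prodOp s S) =
      colOp s x ^ #S := by
  refine (Finset.map_noncommProd S _ _ _).trans (noncommProd_eq_pow_card _ _ _ _ fun k _ => ?_)
  rw [incidenceMap_colOp]
  simp

/-- The sequence `f(x, …, x)` (with `n` arguments) of values of a symmetric function `f`. -/
noncomputable def constSpecialization (x : K) : SymFun K →ₐ[K] (ℕ → K) :=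
  AlgHom.pi fun n =>
    (MvPolynomial.aeval fun _ => x).comp (restrictVars K (Fin.valEmbedding (n := n)))

theorem constSpecialization_rppSeries (s x : K) {μ lam : YoungDiagram} (h : μ ≤ lam) :
    constSpecialization x ⟨rppSeries s lam μ, rppSeries_mem_symFun s h⟩ =
      fun n => (colOp s x ^ n) μ lam := by
  funext n
  have hpow := incidenceMap_aeval_prodOp s x (univ : Finset (Fin n))
  rw [card_fin] at hpow
  rw [← hpow, incidenceMap_apply, ← restrictVars_rppSeries Fin.valEmbedding s h]
  rfl

theorem eq_sum_schurCoeff_smul_rppSeries (f : SymFun K) :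
    f = ∑ lam ∈ (finite_support_schurCoeff f.2).toFinset, schurCoeff (f : MvPowerSeries ℕ K) lam •
      (⟨rppSeries 0 lam ⊥, rppSeries_mem_symFun 0 bot_le⟩ : SymFun K) := by
  refine Subtype.ext ?_
  rw [AddSubmonoidClass.coe_finsetSum]
  simp only [SetLike.val_smul, rppSeries_zero]
  exact eq_sum_schurCoeff_smul f.2.1 (Set.Finite.coe_toFinset _).superset

theorem constSpecialization_mem_polynomialSeq (x : K) (f : SymFun K) :
    constSpecialization x f ∈ polynomialSeq K := by
  rw [eq_sum_schurCoeff_smul_rppSeries f, map_sum]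
  refine sum_mem fun lam _ => ?_
  rw [map_smul, constSpecialization_rppSeries 0 x bot_le]
  exact Subalgebra.smul_mem _ (incidence_pow_mem_polynomialSeq (colOp_apply_self 0 x) ⊥ lam) _

/-- The value at `n = -1` of the polynomial sequence `n ↦ f(-t, …, -t)` (with `n` arguments). By the
Cauchy identity, `f(-t, …, -t)` is the pairing of `f` with `∏ᵢ (1 + t xᵢ)⁻ⁿ`, so the value at
`n = -1` is the pairing with `E t`. -/
noncomputable def pairingHom (t : K) : SymFun K →ₐ[K] K :=
  (polynomialSeq.evalNegOne K).comp
    ((constSpecialization (-t)).codRestrict _ (constSpecialization_mem_polynomialSeq (-t)))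

theorem pairingHom_rppSeries (s t : K) {μ lam : YoungDiagram} (h : μ ≤ lam) :
    pairingHom t ⟨rppSeries s lam μ, rppSeries_mem_symFun s h⟩ = vertOp s t μ lam := by
  rw [← evalNegOne_incidence_pow (colOp_apply_self s (-t)) (vertOp_mul_colOp_neg s t)]
  exact congrArg (polynomialSeq.evalNegOne K) (Subtype.ext (constSpecialization_rppSeries s (-t) h))

theorem schurCoeff_elemGen_eq_vertOp (t : K) (lam : YoungDiagram) :
    schurCoeff (elemGen t) lam = vertOp 0 t ⊥ lam := by
  have hcols : numCols lam ⊥ ≤ lam.card := by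
    rw [YoungDiagram.card, ← skewCells_bot]
    exact card_image_le
  rw [schurCoeff_elemGen, vertOp_apply 0 t bot_le, skewWeight, add_zero, skewCells_bot, ← pow_add,
    ← YoungDiagram.card, Nat.add_sub_cancel' hcols]

theorem pairingHom_eq_hall (t : K) (f : SymFun K) : pairingHom t f = hall (E t) f := by
  conv_lhs => rw [eq_sum_schurCoeff_smul_rppSeries f]
  rw [map_sum, hall, finsum_eq_sum_of_support_subset _ <|
    (Function.support_mul_subset_right _ _).trans (Set.Finite.coe_toFinset _).superset]
  refine sum_congr rfl fun lam _ => ?_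
  rw [map_smul, pairingHom_rppSeries 0 t bot_le, ← schurCoeff_elemGen_eq_vertOp, smul_eq_mul,
    mul_comm]
  rfl

theorem dualGroth_mem_symFun {lam μ : YoungDiagram} (h : μ ≤ lam) :
    dualGroth K lam μ ∈ SymFun K :=
  rppSeries_one (K := K) lam μ ▸ rppSeries_mem_symFun 1 h

theorem hall_E_dualGroth (t : K) {lam μ : YoungDiagram} (h : μ ≤ lam) :
    hall (E t) ⟨dualGroth K lam μ, dualGroth_mem_symFun h⟩ =
      if IsVerticalStrip lam μ then
        t ^ numCols lam μ * (t + 1) ^ (#(skewCells lam μ) - numCols lam μ)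
      else 0 := by
  simp only [← rppSeries_one]
  rw [← pairingHom_eq_hall, pairingHom_rppSeries 1 t h, vertOp_apply 1 t h, skewWeight]

theorem hall_E_dualGroth_oneColumn (t : K) (n : ℕ) :
    hall (E t) ⟨dualGroth K (oneColumn n) ⊥, dualGroth_mem_symFun bot_le⟩ =
      t ^ min n 1 * (t + 1) ^ (n - 1) := by
  rw [hall_E_dualGroth t bot_le, if_pos (isVerticalStrip_bot_iff.2 ⟨n, rfl⟩), numCols_oneColumn,
    skewCells_bot, ← YoungDiagram.card, card_oneColumn]
  congr 2
  omega

end Pairing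

end DualGrothendieck

theorem mainTheorem6 {K : Type*} [CommRing K] (t : K) :
    -- every skew function belongs to the ring of symmetric functions
    ∃ hg : ∀ lam μ : YoungDiagram, μ ≤ lam →
        DualGrothendieck.dualGroth K lam μ ∈ DualGrothendieck.SymFun K,
      -- the pairing with `E(t)` is a ring homomorphism
      (∃ φ : DualGrothendieck.SymFun K →ₐ[K] K,
        ∀ f, φ f = DualGrothendieck.hall (DualGrothendieck.E t) f) ∧
      -- its value on skew shapes
      (∀ (lam μ : YoungDiagram) (h : μ ≤ lam),
        DualGrothendieck.hall (DualGrothendieck.E t)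
            ⟨DualGrothendieck.dualGroth K lam μ, hg lam μ h⟩ =
          if DualGrothendieck.IsVerticalStrip lam μ then
            t ^ DualGrothendieck.numCols lam μ *
              (t + 1) ^ ((DualGrothendieck.skewCells lam μ).card -
                DualGrothendieck.numCols lam μ)
          else 0) ∧
      -- its value on straight shapes
      (DualGrothendieck.hall (DualGrothendieck.E t)
          ⟨DualGrothendieck.dualGroth K ⊥ ⊥, hg ⊥ ⊥ bot_le⟩ = 1) ∧
      (∀ n : ℕ, 1 ≤ n →
        DualGrothendieck.hall (DualGrothendieck.E t)
            ⟨DualGrothendieck.dualGroth K (DualGrothendieck.oneColumn n) ⊥,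
              hg (DualGrothendieck.oneColumn n) ⊥ bot_le⟩ =
          t * (t + 1) ^ (n - 1)) ∧
      (∀ lam : YoungDiagram, lam ≠ ⊥ → (∀ n : ℕ, 1 ≤ n → lam ≠ DualGrothendieck.oneColumn n) →
        DualGrothendieck.hall (DualGrothendieck.E t)
            ⟨DualGrothendieck.dualGroth K lam ⊥, hg lam ⊥ bot_le⟩ = 0) := by
  refine ⟨fun _ _ => DualGrothendieck.dualGroth_mem_symFun,
    ⟨DualGrothendieck.pairingHom t, DualGrothendieck.pairingHom_eq_hall t⟩,
    fun _ _ => DualGrothendieck.hall_E_dualGroth t, ?_, fun n hn => ?_, fun lam hbot hcol => ?_⟩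
  · exact (DualGrothendieck.hall_E_dualGroth_oneColumn t 0).trans (by simp)
  · rw [DualGrothendieck.hall_E_dualGroth_oneColumn, min_eq_right hn, pow_one]
  · rw [DualGrothendieck.hall_E_dualGroth t bot_le, if_neg]
    intro hstrip
    obtain ⟨n, rfl⟩ := DualGrothendieck.isVerticalStrip_bot_iff.1 hstrip
    obtain rfl | hn := Nat.eq_zero_or_pos n
    · exact hbot rfl
    · exact hcol n hn rfl
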